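/- Let $d\ge 2$, let $V\in C^2(\mathbb R^d)$ with $C_b:=\int_{\mathbb R^d}e^{-2V(u)}\,du<\infty$, and put $b=-\nabla V$, $\mu_b(x)=C_b^{-1}e^{-2V(x)}$; write also $\mu_b$ for the probability measure with this density, $\mu_b(g)=\int g\,d\mu_b$, and $\|\cdot\|_{\mu_b}$ for the norm of $L^2(\mu_b)$. Let $X=(X_t)_{t\ge 0}$ be a continuous solution of $$dX_t=b(X_t)\,dt+dW_t,\qquad t\ge 0,$$ where $W$ is a $d$-dimensional standard Brownian motion and $X_0$ is independent of $W$ with law $\mu_b$. Let $P_{b,t}f(x)=\mathbf E_b[f(X_t)\mid X_0=x]$ for $f\in L^2(\mu_b)$. Assume: (A1) there is $\rho>0$ such that $\|P_{b,t}f-\mu_b(f)\|_{\mu_b}\le e^{-t\rho}\|f\|_{\mu_b}$ for all $f\in L^2(\mu_b)$ and all $t>0$; (A2) $P_{b,t}$ has a transition density $p_{b,t}$, that is $P_{b,t}f(x)=\int f(y)p_{b,t}(x,y)\,dy$, and there is $C_0>0$ such that $p_{b,t}(x,y)\le C_0(t^{-d/2}+t^{3d/2})$ for all $t>0$ and all $x,y\in\mathbb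 R^d$ with $|x-y|^2<t$. Let $r>0$, and let $f:\mathbb R^d\to\mathbb R$ be bounded and measurable and vanish outside a Borel set $\mathcal S$ (for example, $\mathcal S$ is the support of $f$) with $\operatorname{diam}(\mathcal S)^d<r^d|\mathcal S|$ and $|\mathcal S|<1$, where $|\cdot|$ denotes Lebesgue measure. Then there is a constant $C$ depending only on $r$, $d$, $C_0$ and $\rho$ (and not on $V$, $f$, $\mathcal S$, $T$) such that for every $T>0$ the random variable $\int_0^T f(X_t)\,dt$ is square-integrable and $$\operatorname{Var}_b\Big(\int_0^T f(X_t)\,dt\Big)\le C\,T\,\|f\|_\infty^2\,\mu_b(\mathcal S)\,|\mathcal S|\,\psi_d(|\mathcal S|)^2,$$ where $\|f\|_\infty=\sup_{x\in\mathbb R^d}|f(x)|$, $\psi_2(x)=\max\big(1,(\log(1/x))^2\big)$, and $\psi_d(x)=x^{1/d-1/2}$ for $d\ge 3$. -/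

import Mathlib

open MeasureTheory ProbabilityTheory
open scoped NNReal ENNReal

noncomputable section

namespace LangevinDiffusion

/-- `d`-dimensional standard Brownian motion started at `0`, indexed by `[0, ∞)`: the coordinates
are independent real Brownian motions (with almost surely continuous paths). -/
structure IsBrownian {d : ℕ} {Ω : Type*} [MeasurableSpace Ω]
    (W : ℝ≥0 → Ω → EuclideanSpace ℝ (Fin d)) (P : Measure Ω) : Prop where
  measurable : ∀ t, Measurable (W t)
  coord : ∀ i, IsBrownianReal (fun t ω => W t ω i) P
  indep : iIndepFun (fun (i : Fin d) (ω : Ω) (t : ℝ≥0) => W t ω i) P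

/-- `X` is a solution of `dX_t = b(X_t) dt + dW_t`, `t ≥ 0`, where `W` is a `d`-dimensional
Brownian motion and the initial value `X_0` is independent of `W`. -/
structure IsSolution {d : ℕ} {Ω : Type*} [MeasurableSpace Ω]
    (b : EuclideanSpace ℝ (Fin d) → EuclideanSpace ℝ (Fin d))
    (X W : ℝ≥0 → Ω → EuclideanSpace ℝ (Fin d)) (P : Measure Ω) : Prop where
  measurable : ∀ t, Measurable (X t)
  brownian : IsBrownian W P
  indep : IndepFun (X 0) (fun ω t => W t ω) P
  continuous_paths : ∀ᵐ ω ∂P, Continuous (fun t => X t ω)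
  equation : ∀ᵐ ω ∂P, ∀ t : ℝ≥0,
    X t ω = X 0 ω + (∫ s in (0 : ℝ)..t, b (X s.toNNReal ω)) + W t ω

/-- The density `μ_b(x) = C_b⁻¹ exp(-2 V(x))`, `C_b = ∫ exp(-2 V(u)) du`, for `b = -∇V`. -/
def gibbsDensity {d : ℕ} (V : EuclideanSpace ℝ (Fin d) → ℝ) (x : EuclideanSpace ℝ (Fin d)) : ℝ :=
  (∫ u, Real.exp (-2 * V u))⁻¹ * Real.exp (-2 * V x)

/-- The measure `μ_b(x) dx`. -/
def gibbsMeasure {d : ℕ} (V : EuclideanSpace ℝ (Fin d) → ℝ) :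
    Measure (EuclideanSpace ℝ (Fin d)) :=
  volume.withDensity (fun x => ENNReal.ofReal (gibbsDensity V x))

/-- The transition operator `P_t f(x) = E[f(X_t) | X_0 = x]`, the integral of `f` against the
regular conditional distribution of `X_t` given `X_0 = x`. -/
def transitionOp {d : ℕ} {Ω : Type*} [MeasurableSpace Ω]
    (P : Measure Ω) [IsFiniteMeasure P] (X : ℝ≥0 → Ω → EuclideanSpace ℝ (Fin d)) (t : ℝ≥0)
    (f : EuclideanSpace ℝ (Fin d) → ℝ) (x : EuclideanSpace ℝ (Fin d)) : ℝ :=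
  ∫ y, f y ∂(condDistrib (X t) (X 0) P x)

/-- `p_t(x, y)` is a (jointly measurable version of the) transition density: for `t > 0` the
conditional distribution of `X_t` given `X_0 = x` is `p_t(x, y) dy`, for almost every `x` with
respect to the law of `X_0`. -/
structure IsTransitionDensity {d : ℕ} {Ω : Type*} [MeasurableSpace Ω]
    (P : Measure Ω) [IsFiniteMeasure P] (X : ℝ≥0 → Ω → EuclideanSpace ℝ (Fin d))
    (p : ℝ≥0 → EuclideanSpace ℝ (Fin d) → EuclideanSpace ℝ (Fin d) → ℝ) : Prop where
  measurable : ∀ t, 0 < t → Measurable (Function.uncurry (p t))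
  nonneg : ∀ t, 0 < t → ∀ x y, 0 ≤ p t x y
  condDistrib_eq : ∀ t, 0 < t → ∀ᵐ x ∂(P.map (X 0)),
    condDistrib (X t) (X 0) P x = volume.withDensity (fun y => ENNReal.ofReal (p t x y))

/-- The spectral gap inequality with constant `ρ` for the semigroup of `X` on `L²(μ)`:
`‖P_t f - μ(f)‖_μ ≤ exp(-t ρ) ‖f‖_μ` for all `f ∈ L²(μ)` and all `t > 0`. -/
def SpectralGap {d : ℕ} {Ω : Type*} [MeasurableSpace Ω]
    (P : Measure Ω) [IsFiniteMeasure P] (X : ℝ≥0 → Ω → EuclideanSpace ℝ (Fin d))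
    (μ : Measure (EuclideanSpace ℝ (Fin d))) (ρ : ℝ) : Prop :=
  ∀ f : EuclideanSpace ℝ (Fin d) → ℝ, MemLp f 2 μ → ∀ t : ℝ≥0, 0 < t →
    eLpNorm (fun x => transitionOp P X t f x - ∫ y, f y ∂μ) 2 μ
      ≤ ENNReal.ofReal (Real.exp (-(t * ρ))) * eLpNorm f 2 μ

/-- The bound `p_t(x, y) ≤ C₀ (t^{-d/2} + t^{3d/2})` for `t > 0` and `|x - y|² < t`. -/
def TransitionDensityBound {d : ℕ}
    (p : ℝ≥0 → EuclideanSpace ℝ (Fin d) → EuclideanSpace ℝ (Fin d) → ℝ) (C₀ : ℝ) : Prop :=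
  ∀ t : ℝ≥0, 0 < t → ∀ x y : EuclideanSpace ℝ (Fin d), ‖x - y‖ ^ 2 < (t : ℝ) →
    p t x y ≤ C₀ * ((t : ℝ) ^ (-(d : ℝ) / 2) + (t : ℝ) ^ (3 * (d : ℝ) / 2))

/-- The rate `ψ_2(x) = max(1, (log(1/x))²)` and `ψ_d(x) = x^{1/d - 1/2}` for `d ≥ 3`. -/
def psi (d : ℕ) (x : ℝ) : ℝ :=
  if d = 2 then max 1 (Real.log (1 / x) ^ 2) else x ^ (1 / (d : ℝ) - 1 / 2)

end LangevinDiffusion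

end

/-! Under stationarity the variance is a double time integral of the autocovariance of `f (X t)`,
hence at most `2T` times the integral over lags `u > 0` of any nonnegative majorant. Let `a = ‖f‖²
μ(S)` and `s = |S|`. Three bounds hold: `a` for every lag; `a·s·C₀(u^{-d/2} + u^{3d/2})` from the
density bound, once `u` exceeds `δ = r² s^{2/d}`, which dominates all squared distances in `S`; and
`a·e^{-ρu}` from the spectral gap. Using them on `(0, δ]`, on `(δ, D]` with `D = log(1/s)/ρ`, and
beyond `D` gives an integral of order `a·s·ψ_d(s)²` (`rate_bounds`, `exists_covariance_majorant`,
`integral_sq_integral_le`).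

Stationarity is not a hypothesis; it is derived. Since the drift is locally Lipschitz, `X (s + u)`
is a fixed measurable function (`flowMap`, a limit of Euler schemes) of `X s` and of the noise after
`s`, and these two are independent. This is the Markov property (`IsSolution.map_prodMk`). Together
with the convergence to the initial law forced by the spectral gap, it makes that law invariant
(`IsSolution.map_eq_map_zero`). -/

namespace LangevinDiffusion

open Filter Topology

/-! ### Solutions as measurable functions of initial value and noise -/

section Euler

variable {E : Type*} [NormedAddCommGroup E] [NormedSpace ℝ E]

/-- The Euler scheme with step `h` for `dx = b(x) dt + dw`, started at `x`. -/
noncomputable def eulerScheme (b : E → E) (h : ℝ≥0) (x : E) (w : ℝ≥0 → E) : ℕ → E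
  | 0 => x
  | k + 1 => eulerScheme b h x w k + (h : ℝ) • b (eulerScheme b h x w k)
      + (w (((k + 1 : ℕ) : ℝ≥0) * h) - w ((k : ℝ≥0) * h))

/-- Discrete Grönwall: the noise increments cancel in the error, leaving `e_{k+1} ≤ (1 + hK) e_k +
εh`, where `ε` is the oscillation of the drift along the solution over one step. No regularity of
`w` is needed. -/
theorem norm_sub_eulerScheme_le [CompleteSpace E] {b : E → E} (hb : Continuous b) {R : ℝ} {K : ℝ≥0}
    (hK : LipschitzOnWith K b (Metric.closedBall 0 (R + 1))) {t : ℝ≥0} {x w : ℝ≥0 → E}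
    (hx : Continuous x)
    (hxw : ∀ u ≤ t, x u = x 0 + (∫ s in (0 : ℝ)..u, b (x s.toNNReal)) + w u)
    (hR : ∀ u ≤ t, ‖x u‖ ≤ R) {h : ℝ≥0} {ε : ℝ} (hε : 0 ≤ ε)
    (hε1 : t * ε * Real.exp (K * t) ≤ 1)
    (hosc : ∀ u v : ℝ≥0, u ≤ t → v ≤ t → dist u v ≤ h → ‖b (x u) - b (x v)‖ ≤ ε)
    (k : ℕ) (hk : (k : ℝ≥0) * h ≤ t) :
    ‖x (k * h) - eulerScheme b h (x 0) w k‖ ≤ k * h * ε * Real.exp (K * (k * h)) := by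
  induction k with
  | zero => simp [eulerScheme]
  | succ k ih =>
    have hkk : (k : ℝ≥0) * h ≤ ((k + 1 : ℕ) : ℝ≥0) * h := by gcongr; simp
    have hk' := hkk.trans hk
    specialize ih hk'
    have hkr : (k : ℝ) * h ≤ t := by exact_mod_cast hk'
    have hkr1 : ((k : ℝ) + 1) * h ≤ t := by exact_mod_cast hk
    have hh : (0 : ℝ) ≤ h := h.2
    have hint : ∀ p q : ℝ, IntervalIntegrable (fun s => b (x s.toNNReal)) volume p q := fun p q =>
      Continuous.intervalIntegrable (by fun_prop) _ _
    set e := eulerScheme b h (x 0) w k with he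
    -- An error of at most 1 keeps the scheme in the ball of radius `R + 1`, where the Lipschitz
    -- constant is valid.
    have hle1 : ‖x (k * h) - e‖ ≤ 1 := by
      refine ih.trans (le_trans ?_ hε1)
      gcongr
    have hxe : ‖e‖ ≤ R + 1 := by
      have := norm_sub_norm_le e (x (k * h))
      rw [norm_sub_rev] at this
      linarith [hR _ hk']
    have hlip : ‖b (x (k * h)) - b e‖ ≤ K * ‖x (k * h) - e‖ := by
      refine hK.norm_sub_le ?_ ?_
      · simpa using (hR _ hk').trans (by linarith)
      · simpa using hxe
    have hincr : x (((k + 1 : ℕ) : ℝ≥0) * h) - eulerScheme b h (x 0) w (k + 1)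
        = (x (k * h) - e) + (∫ s in ((k : ℝ) * h)..((k + 1 : ℝ) * h),
            (b (x s.toNNReal) - b (x (k * h)))) + (h : ℝ) • (b (x (k * h)) - b e) := by
      have e1 := hxw _ hk
      have e2 := hxw _ hk'
      have e3 := intervalIntegral.integral_interval_sub_left
        (hint 0 ((k + 1 : ℝ) * h)) (hint 0 ((k : ℝ) * h))
      rw [intervalIntegral.integral_sub (hint _ _) (by simp), intervalIntegral.integral_const,
        ← e3, eulerScheme, ← he]
      push_cast at e1 e2 ⊢
      have e4 : ((k : ℝ) + 1) * h - k * h = h := by ring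
      rw [e1, e4, smul_sub]
      nth_rw 1 [e2]
      abel
    have hI : ‖∫ s in ((k : ℝ) * h)..((k + 1 : ℝ) * h),
        (b (x s.toNNReal) - b (x (k * h)))‖ ≤ ε * h := by
      have := intervalIntegral.norm_integral_le_of_norm_le_const (C := ε)
        (f := fun s => b (x s.toNNReal) - b (x (k * h)))
        (a := (k : ℝ) * h) (b := (k + 1 : ℝ) * h) ?_
      · refine this.trans_eq ?_
        rw [show ((k : ℝ) + 1) * h - k * h = h by ring, abs_of_nonneg hh]
      · intro s hs
        rw [Set.uIoc_of_le (by nlinarith)] at hs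
        have hs0 : 0 ≤ s := le_trans (by positivity) hs.1.le
        refine hosc _ _ ?_ hk' ?_
        · rw [← NNReal.coe_le_coe, Real.coe_toNNReal _ hs0]; linarith [hs.2]
        · rw [NNReal.dist_eq, Real.coe_toNNReal _ hs0]
          push_cast
          rw [abs_of_nonneg (by linarith [hs.1])]
          linarith [hs.2]
    rw [hincr]
    have hexp : (1 + h * K) ≤ Real.exp (h * K) := by linarith [Real.add_one_le_exp ((h : ℝ) * K)]
    have hexp1 : 1 ≤ Real.exp (K * ((k + 1 : ℝ) * h)) := Real.one_le_exp (by positivity)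
    calc _ ≤ ‖x (k * h) - e‖ + ε * h + h * (K * ‖x (k * h) - e‖) := by
          refine (norm_add_le _ _).trans (add_le_add ((norm_add_le _ _).trans (by gcongr)) ?_)
          rw [norm_smul, Real.norm_of_nonneg hh]
          gcongr
      _ = (1 + h * K) * ‖x (k * h) - e‖ + ε * h * 1 := by ring
      _ ≤ Real.exp (h * K) * (k * h * ε * Real.exp (K * (k * h)))
          + ε * h * Real.exp (K * ((k + 1 : ℝ) * h)) := by gcongr
      _ = k * h * ε * (Real.exp (h * K) * Real.exp (K * (k * h)))
          + ε * h * Real.exp (K * ((k + 1 : ℝ) * h)) := by ring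
      _ = _ := by
          rw [← Real.exp_add]
          push_cast
          ring_nf

/-- The Euler scheme of a locally Lipschitz drift converges to the solution. -/
theorem tendsto_eulerScheme [CompleteSpace E] {b : E → E} (hb : Continuous b)
    (hlip : ∀ R : ℝ, ∃ K : ℝ≥0, LipschitzOnWith K b (Metric.closedBall 0 R))
    {t : ℝ≥0} {x w : ℝ≥0 → E} (hx : Continuous x)
    (hxw : ∀ u ≤ t, x u = x 0 + (∫ s in (0 : ℝ)..u, b (x s.toNNReal)) + w u) :
    Tendsto (fun n : ℕ => eulerScheme b (t / (n + 1 : ℕ)) (x 0) w (n + 1)) atTop (𝓝 (x t)) := by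
  have hcomp : IsCompact (Set.Iic t) := by
    rw [← Set.Icc_bot]; exact isCompact_Icc
  obtain ⟨R, hR⟩ := hcomp.exists_bound_of_continuousOn hx.continuousOn
  obtain ⟨K, hK⟩ := hlip (R + 1)
  have huc := hcomp.uniformContinuousOn_of_continuous (hb.comp hx).continuousOn
  rw [Metric.uniformContinuousOn_iff] at huc
  rw [Metric.tendsto_atTop]
  intro ε hε
  -- The 1 in the minimum keeps the scheme in the larger ball; `ε / 2` gives convergence.
  set η := min 1 (ε / 2) / (t * Real.exp (K * t) + 1) with hη
  have hη0 : 0 < η := by positivity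
  have hηle : t * η * Real.exp (K * t) ≤ min 1 (ε / 2) := by
    have : t * η * Real.exp (K * t) = η * (t * Real.exp (K * t)) := by ring
    rw [this]
    calc η * (t * Real.exp (K * t)) ≤ η * (t * Real.exp (K * t) + 1) := by gcongr; linarith
      _ = _ := by rw [hη]; field_simp
  obtain ⟨δ, hδ, hδ'⟩ := huc η hη0
  obtain ⟨N, hN⟩ := exists_nat_gt ((t : ℝ) / δ)
  refine ⟨N, fun n hn => ?_⟩
  have hlt : ((t / (n + 1 : ℕ) : ℝ≥0) : ℝ) < δ := by
    push_cast
    rw [div_lt_iff₀ (by positivity)]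
    rw [div_lt_iff₀ hδ] at hN
    have : (N : ℝ) ≤ n := by exact_mod_cast hn
    nlinarith
  have hmul : ((n + 1 : ℕ) : ℝ≥0) * (t / (n + 1 : ℕ)) = t := by
    rw [mul_div_cancel₀]; positivity
  have := norm_sub_eulerScheme_le hb hK hx hxw (fun u hu => hR u hu) (h := t / (n + 1 : ℕ))
    hη0.le (hηle.trans (min_le_left _ _))
    (fun u v hu hv huv => by
      have := hδ' u hu v hv (huv.trans_lt hlt)
      rw [dist_eq_norm] at this
      exact this.le) (n + 1) hmul.le
  rw [hmul] at this
  rw [dist_comm, dist_eq_norm]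
  refine this.trans_lt ?_
  have h2 : ((n + 1 : ℕ) : ℝ) * ((t / (n + 1 : ℕ) : ℝ≥0) : ℝ) = t := by exact_mod_cast hmul
  rw [h2]
  calc _ ≤ min 1 (ε / 2) := hηle
    _ ≤ ε / 2 := min_le_right _ _
    _ < ε := by linarith

theorem measurable_eulerScheme [MeasurableSpace E] [BorelSpace E] [SecondCountableTopology E]
    {b : E → E} (hb : Measurable b) (h : ℝ≥0) (k : ℕ) :
    Measurable (fun z : E × (ℝ≥0 → E) => eulerScheme b h z.1 z.2 k) := by
  induction k with
  | zero => exact measurable_fst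
  | succ k ih =>
    simp only [eulerScheme]
    have := hb.comp ih
    fun_prop

/-- The time-`t` value of the solution of `dx = b(x) dt + dw` started at `x`, as the limit of the
Euler schemes. -/
noncomputable def flowMap [Nonempty E] (b : E → E) (t : ℝ≥0) (z : E × (ℝ≥0 → E)) : E :=
  limUnder atTop (fun n : ℕ => eulerScheme b (t / (n + 1 : ℕ)) z.1 z.2 (n + 1))

theorem measurable_flowMap [MeasurableSpace E] [BorelSpace E] [SecondCountableTopology E]
    [CompleteSpace E] {b : E → E} (hb : Measurable b) (t : ℝ≥0) :
    Measurable (flowMap b t) :=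
  (StronglyMeasurable.limUnder fun _ => (measurable_eulerScheme hb _ _).stronglyMeasurable).measurable

/-- The Euler schemes depend only on the initial point and the noise, so their limit expresses every
solution by one map. The equation is required only up to time `t`, so the noise may be altered
afterwards. -/
theorem eq_flowMap [CompleteSpace E] {b : E → E} (hb : Continuous b)
    (hlip : ∀ R : ℝ, ∃ K : ℝ≥0, LipschitzOnWith K b (Metric.closedBall 0 R))
    {t : ℝ≥0} {x w : ℝ≥0 → E} (hx : Continuous x)
    (hxw : ∀ u ≤ t, x u = x 0 + (∫ s in (0 : ℝ)..u, b (x s.toNNReal)) + w u) :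
    x t = flowMap b t (x 0, w) :=
  (tendsto_eulerScheme hb hlip hx hxw).limUnder_eq.symm

end Euler

/-! ### Independence, and Brownian increments after a fixed time -/

/-- The joint law is a product over `i` of laws `A i ⊗ B i`; rearranging the factors gives the
product of the two vector laws. This lifts independence of past and future from coordinates to
vectors. -/
theorem indepFun_pi_of_iIndepFun_prodMk {ι Ω α β : Type*} [Fintype ι] [MeasurableSpace Ω]
    [MeasurableSpace α] [MeasurableSpace β] {P : Measure Ω} [IsProbabilityMeasure P]
    {A : ι → Ω → α} {B : ι → Ω → β} (hA : ∀ i, Measurable (A i)) (hB : ∀ i, Measurable (B i))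
    (h : iIndepFun (fun i ω => (A i ω, B i ω)) P) (hAB : ∀ i, IndepFun (A i) (B i) P) :
    IndepFun (fun ω i => A i ω) (fun ω i => B i ω) P := by
  have hiA : iIndepFun A P := h.comp (fun _ => Prod.fst) (fun _ => measurable_fst)
  have hiB : iIndepFun B P := h.comp (fun _ => Prod.snd) (fun _ => measurable_snd)
  have : ∀ i, IsProbabilityMeasure (P.map (A i)) := fun i =>
    Measure.isProbabilityMeasure_map (hA i).aemeasurable
  have : ∀ i, IsProbabilityMeasure (P.map (B i)) := fun i =>
    Measure.isProbabilityMeasure_map (hB i).aemeasurable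
  rw [indepFun_iff_map_prod_eq_prod_map_map (by fun_prop) (by fun_prop),
    hiA.map_fun_eq_pi_map (by fun_prop), hiB.map_fun_eq_pi_map (by fun_prop),
    ← (measurePreserving_arrowProdEquivProdArrow α β ι (fun i => P.map (A i))
      (fun i => P.map (B i))).map_eq]
  have h1 := h.map_fun_eq_pi_map (by fun_prop)
  have h2 : (fun i => P.map fun ω => (A i ω, B i ω)) = fun i => (P.map (A i)).prod (P.map (B i)) :=
    funext fun i => (indepFun_iff_map_prod_eq_prod_map_map (by fun_prop) (by fun_prop)).1 (hAB i)
  rw [← h2, ← h1, Measure.map_map (MeasurableEquiv.measurable _) (by fun_prop)]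
  rfl

/-- Both hypotheses together make the law of the triple a product, so it can be regrouped; equality
is checked on boxes. -/
theorem IndepFun.prodMk_of_indepFun_prodMk {Ω α β γ : Type*} [MeasurableSpace Ω]
    [MeasurableSpace α] [MeasurableSpace β] [MeasurableSpace γ] {P : Measure Ω}
    [IsProbabilityMeasure P] {F : Ω → α} {G : Ω → β} {Z : Ω → γ} (hF : Measurable F)
    (hG : Measurable G) (hZ : Measurable Z) (hFG : IndepFun F G P)
    (h : IndepFun Z (fun ω => (F ω, G ω)) P) : IndepFun F (fun ω => (Z ω, G ω)) P := by
  have hZG : IndepFun Z G P := h.comp measurable_id measurable_snd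
  have : IsProbabilityMeasure (P.map F) := Measure.isProbabilityMeasure_map hF.aemeasurable
  have : IsProbabilityMeasure (P.map G) := Measure.isProbabilityMeasure_map hG.aemeasurable
  have : IsProbabilityMeasure (P.map Z) := Measure.isProbabilityMeasure_map hZ.aemeasurable
  rw [indepFun_iff_map_prod_eq_prod_map_map (by fun_prop) (by fun_prop)] at *
  rw [hFG] at h
  rw [hZG]
  refine Measure.ext_prod₃ fun {s t u} hs ht hu => ?_
  have h1 := congrArg (fun m => m (t ×ˢ (s ×ˢ u))) h
  simp only [Measure.prod_prod] at h1 ⊢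
  rw [Measure.map_apply (by fun_prop) (ht.prod (hs.prod hu))] at h1
  rw [Measure.map_apply (by fun_prop) (hs.prod (ht.prod hu)), ← mul_assoc,
    mul_comm (P.map F s), mul_assoc, ← h1]
  congr 1
  ext ω
  simp only [Set.mem_preimage, Set.mem_prod]
  tauto

/-- The path in Euclidean space with given coordinate paths. -/
def pathOfCoord {d : ℕ} {T : Type*} (x : Fin d → T → ℝ) (t : T) : EuclideanSpace ℝ (Fin d) :=
  WithLp.toLp 2 fun i => x i t

theorem measurable_pathOfCoord {d : ℕ} {T : Type*} :
    Measurable (pathOfCoord : (Fin d → T → ℝ) → T → EuclideanSpace ℝ (Fin d)) := by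
  unfold pathOfCoord
  fun_prop

namespace IsBrownian

variable {d : ℕ} {Ω : Type*} [MeasurableSpace Ω] {W : ℝ≥0 → Ω → EuclideanSpace ℝ (Fin d)}
  {P : Measure Ω}

theorem measurable_coord (hW : IsBrownian W P) (t : ℝ≥0) (i : Fin d) :
    Measurable (fun ω => W t ω i) := by
  have := hW.measurable t
  fun_prop

theorem measurable_coord_path (hW : IsBrownian W P) (i : Fin d) :
    Measurable (fun ω (t : ℝ≥0) => W t ω i) :=
  measurable_pi_lambda _ fun _ => hW.measurable_coord _ _

theorem measurable_coord_shift (hW : IsBrownian W P) (s : ℝ≥0) (i : Fin d) :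
    Measurable (fun ω (t : ℝ≥0) => W (s + t) ω i - W s ω i) :=
  measurable_pi_lambda _ fun _ => (hW.measurable_coord _ _).sub (hW.measurable_coord _ _)

/-- The increments of a Brownian motion after time `s` have the law of the Brownian motion. -/
theorem map_shift [IsProbabilityMeasure P] (hW : IsBrownian W P) (s : ℝ≥0) :
    P.map (fun ω t => W (s + t) ω - W s ω) = P.map (fun ω t => W t ω) := by
  have m1 := hW.measurable_coord_path
  have m2 := hW.measurable_coord_shift s
  have h1 : P.map (fun ω i t => W (s + t) ω i - W s ω i) = P.map (fun ω i t => W t ω i) := by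
    have hi : iIndepFun (fun (i : Fin d) (ω : Ω) (t : ℝ≥0) => W (s + t) ω i - W s ω i) P :=
      hW.indep.comp (fun _ x t => x (s + t) - x s) (fun _ => by fun_prop)
    rw [hi.map_fun_eq_pi_map (fun i => (m2 i).aemeasurable),
      hW.indep.map_fun_eq_pi_map (fun i => (m1 i).aemeasurable)]
    congr 1
    funext i
    rw [map_eq_iff_forall_finset_map_restrict_eq (m2 i).aemeasurable (m1 i).aemeasurable]
    intro I
    exact (((hW.coord i).shift s).hasLaw I).map_eq.trans ((hW.coord i).hasLaw I).map_eq.symm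
  have h2 := congrArg (Measure.map pathOfCoord) h1
  rw [Measure.map_map measurable_pathOfCoord (measurable_pi_lambda _ m2),
    Measure.map_map measurable_pathOfCoord (measurable_pi_lambda _ m1)] at h2
  exact h2

/-- The increments of a Brownian motion after time `s` are independent of its past. -/
theorem indepFun_shift [IsProbabilityMeasure P] (hW : IsBrownian W P) (s : ℝ≥0) :
    IndepFun (fun ω t => W (s + t) ω - W s ω) (fun ω (t : Set.Iic s) => W t ω) P := by
  have h1 : IndepFun (fun ω (i : Fin d) (t : ℝ≥0) => W (s + t) ω i - W s ω i)
      (fun ω (i : Fin d) (t : Set.Iic s) => W t ω i) P :=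
    indepFun_pi_of_iIndepFun_prodMk (hW.measurable_coord_shift s)
      (fun i => measurable_pi_lambda _ fun _ => hW.measurable_coord _ _)
      (hW.indep.comp (fun _ x => (fun t => x (s + t) - x s, fun t : Set.Iic s => x t))
        (fun _ => by fun_prop))
      (fun i => (hW.coord i).indepFun_shift s)
  exact h1.comp measurable_pathOfCoord measurable_pathOfCoord

end IsBrownian

/-! ### Transition operators and convergence to the initial law -/

section TransitionOp

variable {d : ℕ} {Ω : Type*} [MeasurableSpace Ω] {P : Measure Ω} [IsProbabilityMeasure P]
  {X : ℝ≥0 → Ω → EuclideanSpace ℝ (Fin d)}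

theorem measurable_transitionOp {f : EuclideanSpace ℝ (Fin d) → ℝ} (hf : Measurable f) (t : ℝ≥0) :
    Measurable (transitionOp P X t f) :=
  (StronglyMeasurable.integral_condDistrib
    (hf.comp measurable_snd).stronglyMeasurable).measurable

theorem abs_transitionOp_le {f : EuclideanSpace ℝ (Fin d) → ℝ} {M : ℝ} (hM : ∀ x, |f x| ≤ M)
    (t : ℝ≥0) (x : EuclideanSpace ℝ (Fin d)) : |transitionOp P X t f x| ≤ M := by
  have := norm_integral_le_of_norm_le_const (μ := condDistrib (X t) (X 0) P x)
    (ae_of_all _ fun y => (Real.norm_eq_abs (f y)).trans_le (hM y))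
  simpa [transitionOp] using this

/-- `E[g(X_0) f(X_t)] = ∫ g P_t f dμ`, where `μ` is the law of `X_0`. -/
theorem integral_mul_eq_integral_mul_transitionOp (hX : ∀ t, Measurable (X t))
    {f g : EuclideanSpace ℝ (Fin d) → ℝ} (hf : Measurable f) (hg : Measurable g) {M N : ℝ}
    (hM : ∀ x, |f x| ≤ M) (hN : ∀ x, |g x| ≤ N) (t : ℝ≥0) :
    ∫ ω, g (X 0 ω) * f (X t ω) ∂P = ∫ x, g x * transitionOp P X t f x ∂(P.map (X 0)) := by
  have : IsProbabilityMeasure (P.map (X 0)) :=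
    Measure.isProbabilityMeasure_map (hX 0).aemeasurable
  have hm : Measurable
      (fun z : EuclideanSpace ℝ (Fin d) × EuclideanSpace ℝ (Fin d) => g z.1 * f z.2) := by
    fun_prop
  have h1 : ∫ ω, g (X 0 ω) * f (X t ω) ∂P
      = ∫ z, g z.1 * f z.2 ∂(P.map fun ω => (X 0 ω, X t ω)) :=
    (integral_map ((hX 0).prodMk (hX t)).aemeasurable hm.aestronglyMeasurable).symm
  rw [h1, ← compProd_map_condDistrib (hX t).aemeasurable, Measure.integral_compProd]
  · simp_rw [integral_const_mul]
    rfl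
  · refine Integrable.of_bound hm.aestronglyMeasurable (N * M) (ae_of_all _ fun z => ?_)
    rw [norm_mul]
    exact mul_le_mul (hN _) (hM _) (norm_nonneg _) ((abs_nonneg _).trans (hN z.1))

/-- On a probability space the `L¹` norm is at most the `L²` norm, so the gap controls the mean of
`P_t f - μ(f)`. -/
theorem SpectralGap.abs_integral_sub_le (hX : ∀ t, Measurable (X t)) {ρ : ℝ}
    (hgap : SpectralGap P X (P.map (X 0)) ρ) {f : EuclideanSpace ℝ (Fin d) → ℝ} (hf : Measurable f)
    (hf1 : ∀ x, |f x| ≤ 1) {t : ℝ≥0} (ht : 0 < t) :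
    |∫ ω, f (X t ω) ∂P - ∫ x, f x ∂(P.map (X 0))| ≤ Real.exp (-(t * ρ)) := by
  have hprob : IsProbabilityMeasure (P.map (X 0)) :=
    Measure.isProbabilityMeasure_map (hX 0).aemeasurable
  have h1 := integral_mul_eq_integral_mul_transitionOp (P := P) hX hf (g := fun _ => 1)
    measurable_const hf1 (fun _ => by rw [abs_one]) t
  simp only [one_mul] at h1
  have hint : Integrable (transitionOp P X t f) (P.map (X 0)) :=
    Integrable.of_bound (measurable_transitionOp hf t).aestronglyMeasurable 1
      (ae_of_all _ fun x => abs_transitionOp_le hf1 t x)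
  set c := ∫ x, f x ∂(P.map (X 0)) with hc
  have h2 : ∫ x, transitionOp P X t f x ∂(P.map (X 0)) - c
      = ∫ x, (transitionOp P X t f x - c) ∂(P.map (X 0)) := by
    rw [integral_sub hint (integrable_const _)]
    simp
  have hm : AEStronglyMeasurable (fun x => transitionOp P X t f x - c) (P.map (X 0)) :=
    ((measurable_transitionOp hf t).sub_const c).aestronglyMeasurable
  have hfb : ∀ᵐ x ∂(P.map (X 0)), ‖f x‖ ≤ 1 := ae_of_all _ hf1
  have h3 := hgap f (MemLp.of_bound hf.aestronglyMeasurable 1 hfb) t ht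
  have h4 : eLpNorm f 2 (P.map (X 0)) ≤ 1 := by
    simpa using eLpNorm_le_of_ae_bound (p := 2) hfb
  have h5 : eLpNorm (fun x => transitionOp P X t f x - c) 1 (P.map (X 0))
      ≤ ENNReal.ofReal (Real.exp (-(t * ρ))) :=
    (eLpNorm_le_eLpNorm_of_exponent_le (by norm_num) hm).trans
      (h3.trans (mul_le_of_le_one_right' h4))
  rw [h1, h2, ← Real.norm_eq_abs, ← ENNReal.ofReal_le_ofReal_iff (by positivity),
    ofReal_norm]
  refine (enorm_integral_le_lintegral_enorm _).trans ?_
  rwa [eLpNorm_one_eq_lintegral_enorm] at h5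

end TransitionOp

/-! ### Markov property and stationarity -/

namespace IsSolution

variable {d : ℕ} {Ω : Type*} [MeasurableSpace Ω] {P : Measure Ω}
  {b : EuclideanSpace ℝ (Fin d) → EuclideanSpace ℝ (Fin d)}
  {X W : ℝ≥0 → Ω → EuclideanSpace ℝ (Fin d)}

theorem measurable_shift (h : IsSolution b X W P) (s : ℝ≥0) :
    Measurable (fun ω t => W (s + t) ω - W s ω) :=
  measurable_pi_lambda _ fun _ => (h.brownian.measurable _).sub (h.brownian.measurable _)

/-- Stopping the noise at `s` exhibits `X s` as a function of `X 0` and the noise up to `s` alone,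
as needed for independence from later increments. -/
theorem ae_eq_flowMap_stopped (h : IsSolution b X W P) (hb : Continuous b)
    (hlip : ∀ R : ℝ, ∃ K : ℝ≥0, LipschitzOnWith K b (Metric.closedBall 0 R)) (s : ℝ≥0) :
    X s =ᵐ[P] fun ω => flowMap b s (X 0 ω, fun t => W (min t s) ω) := by
  filter_upwards [h.continuous_paths, h.equation] with ω hc he
  refine eq_flowMap hb hlip hc (w := fun t => W (min t s) ω) fun u hu => ?_
  rw [min_eq_left hu]
  exact he u

/-- The flow property of the solution. -/
theorem ae_eq_flowMap_shift (h : IsSolution b X W P) (hb : Continuous b)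
    (hlip : ∀ R : ℝ, ∃ K : ℝ≥0, LipschitzOnWith K b (Metric.closedBall 0 R)) (s u : ℝ≥0) :
    X (s + u) =ᵐ[P] fun ω => flowMap b u (X s ω, fun t => W (s + t) ω - W s ω) := by
  filter_upwards [h.continuous_paths, h.equation] with ω hc he
  have := eq_flowMap hb hlip (t := u) (x := fun v => X (s + v) ω)
    (w := fun t => W (s + t) ω - W s ω) (by fun_prop) fun v _ => ?_
  · simpa using this
  have hint : ∀ p q : ℝ, IntervalIntegrable (fun r => b (X r.toNNReal ω)) volume p q :=
    fun p q => Continuous.intervalIntegrable (by fun_prop) _ _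
  have e1 : ∫ r in (0 : ℝ)..v, b (X (s + r.toNNReal) ω)
      = ∫ r in (s : ℝ)..(s + v : ℝ), b (X r.toNNReal ω) := by
    have := intervalIntegral.integral_comp_add_left (a := 0) (b := (v : ℝ))
      (fun r => b (X r.toNNReal ω)) (s : ℝ)
    rw [add_zero] at this
    rw [← this]
    refine intervalIntegral.integral_congr fun r hr => ?_
    rw [Set.uIcc_of_le v.coe_nonneg] at hr
    rw [Real.toNNReal_add s.coe_nonneg hr.1, Real.toNNReal_coe]
  have e2 := intervalIntegral.integral_add_adjacent_intervals (hint 0 s) (hint s (s + v : ℝ))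
  simp only [add_zero]
  have e3 := he (s + v)
  push_cast at e3
  rw [e1, e3, he s, ← e2]
  abel

variable [IsProbabilityMeasure P]

/-- `X 0` is independent of the whole noise and the past noise of the later increments, so the pair
(`X 0`, past) is independent of those increments; `X s` is a function of that pair. -/
theorem indepFun_shift (h : IsSolution b X W P) (hb : Continuous b)
    (hlip : ∀ R : ℝ, ∃ K : ℝ≥0, LipschitzOnWith K b (Metric.closedBall 0 R)) (s : ℝ≥0) :
    IndepFun (X s) (fun ω t => W (s + t) ω - W s ω) P := by
  have hWm := h.brownian.measurable
  have h0 : IndepFun (X 0)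
      (fun ω => (fun t => W (s + t) ω - W s ω, fun t : Set.Iic s => W t ω)) P :=
    h.indep.comp (φ := id) (ψ := fun x : ℝ≥0 → EuclideanSpace ℝ (Fin d) =>
      (fun t => x (s + t) - x s, fun t : Set.Iic s => x t)) measurable_id (by fun_prop)
  have h1 := IndepFun.prodMk_of_indepFun_prodMk (h.measurable_shift s)
    (measurable_pi_lambda _ fun _ => hWm _) (h.measurable 0) (h.brownian.indepFun_shift s) h0
  have h2 := h1.symm.comp (φ := fun z : EuclideanSpace ℝ (Fin d)
      × (Set.Iic s → EuclideanSpace ℝ (Fin d)) =>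
      flowMap b s (z.1, fun t => z.2 ⟨min t s, Set.mem_Iic.2 (min_le_right _ _)⟩)) (ψ := id)
    ((measurable_flowMap hb.measurable s).comp (measurable_fst.prodMk
      (measurable_pi_lambda _ fun _ => (measurable_pi_apply _).comp measurable_snd))) measurable_id
  exact h2.congr (h.ae_eq_flowMap_stopped hb hlip s).symm (ae_eq_refl _)

/-- The Markov property: the joint law of `X_s` and `X_{s+u}` is determined by the law of `X_s`. -/
theorem map_prodMk (h : IsSolution b X W P) (hb : Continuous b)
    (hlip : ∀ R : ℝ, ∃ K : ℝ≥0, LipschitzOnWith K b (Metric.closedBall 0 R)) (s u : ℝ≥0) :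
    P.map (fun ω => (X s ω, X (s + u) ω))
      = ((P.map (X s)).prod (P.map fun ω t => W t ω)).map (fun z => (z.1, flowMap b u z)) := by
  have hm := (h.measurable s).prodMk (h.measurable_shift s)
  have hfl := measurable_flowMap hb.measurable u
  rw [← h.brownian.map_shift s, ← (indepFun_iff_map_prod_eq_prod_map_map
    (h.measurable s).aemeasurable (h.measurable_shift s).aemeasurable).1 (h.indepFun_shift hb hlip s),
    Measure.map_map (measurable_fst.prodMk hfl) hm]
  refine Measure.map_congr ?_
  filter_upwards [h.ae_eq_flowMap_shift hb hlip s u] with ω hω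
  simp [hω]

theorem map_prodMk_eq_of_map_eq (h : IsSolution b X W P) (hb : Continuous b)
    (hlip : ∀ R : ℝ, ∃ K : ℝ≥0, LipschitzOnWith K b (Metric.closedBall 0 R)) {s : ℝ≥0}
    (hs : P.map (X s) = P.map (X 0)) (u : ℝ≥0) :
    P.map (fun ω => (X s ω, X (s + u) ω)) = P.map (fun ω => (X 0 ω, X u ω)) := by
  rw [h.map_prodMk hb hlip s u, hs, ← h.map_prodMk hb hlip 0 u, zero_add]

/-- A solution whose transition operators converge to equilibrium is stationary when started in
equilibrium. -/
theorem map_eq_map_zero (h : IsSolution b X W P) (hb : Continuous b)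
    (hlip : ∀ R : ℝ, ∃ K : ℝ≥0, LipschitzOnWith K b (Metric.closedBall 0 R)) {ρ : ℝ} (hρ : 0 < ρ)
    (hgap : SpectralGap P X (P.map (X 0)) ρ) (s : ℝ≥0) : P.map (X s) = P.map (X 0) := by
  have hmX := h.measurable
  have hWm : Measurable (fun ω t => W t ω) := measurable_pi_lambda _ h.brownian.measurable
  have hprob : IsProbabilityMeasure (P.map fun ω t => W t ω) :=
    Measure.isProbabilityMeasure_map hWm.aemeasurable
  have hpr : ∀ t, IsProbabilityMeasure (P.map (X t)) := fun t =>
    Measure.isProbabilityMeasure_map (hmX t).aemeasurable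
  refine Measure.ext fun A hA => ?_
  have hfl := measurable_flowMap hb.measurable s
  set B := flowMap b s ⁻¹' A with hBdef
  have hB : MeasurableSet B := hfl hA
  -- `k x` is the probability that the flow from `x` lies in `A` at time `s`, so the Markov property
  -- gives `E[k(X_t)] = P(X_{t+s} ∈ A)`.
  set k : EuclideanSpace ℝ (Fin d) → ℝ :=
    fun x => ((P.map fun ω t => W t ω) (Prod.mk x ⁻¹' B)).toReal with hk
  have hkm : Measurable k := (measurable_measure_prodMk_left hB).ennreal_toReal
  have hk1 : ∀ x, |k x| ≤ 1 := fun x => by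
    rw [abs_of_nonneg ENNReal.toReal_nonneg]
    exact measureReal_le_one
  have hkey : ∀ t, ∫ ω, k (X t ω) ∂P = (P.map (X (t + s))).real A := by
    intro t
    have e := congrArg (fun m => m (Prod.snd ⁻¹' A)) (h.map_prodMk hb hlip t s)
    rw [Measure.map_apply ((hmX t).prodMk (hmX (t + s))) (measurable_snd hA),
      Measure.map_apply (measurable_fst.prodMk hfl) (measurable_snd hA)] at e
    have e2 : (P.map (X (t + s))) A = ((P.map (X t)).prod (P.map fun ω t => W t ω)) B := by
      rw [Measure.map_apply (hmX _) hA]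
      exact e
    rw [measureReal_def, e2, Measure.prod_apply hB,
      ← integral_map (hmX t).aemeasurable hkm.aestronglyMeasurable,
      integral_toReal (measurable_measure_prodMk_left hB).aemeasurable
        (ae_of_all _ fun x => measure_lt_top _ _)]
  have hk0 : ∫ x, k x ∂(P.map (X 0)) = (P.map (X s)).real A := by
    rw [integral_map (hmX 0).aemeasurable hkm.aestronglyMeasurable, hkey, zero_add]
  have hind : ∀ t, ∫ ω, A.indicator (fun _ => (1 : ℝ)) (X t ω) ∂P = (P.map (X t)).real A := by
    intro t
    refine (integral_map (hmX t).aemeasurable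
      (measurable_one.indicator hA).aestronglyMeasurable).symm.trans ?_
    exact integral_indicator_one hA
  have hind0 : ∫ x, A.indicator (fun _ => (1 : ℝ)) x ∂(P.map (X 0)) = (P.map (X 0)).real A :=
    integral_indicator_one hA
  -- The number `P(X_{t+s} ∈ A)` is close to the `μ`-mean of `k`, which is `P(X_s ∈ A)`, and to the
  -- `μ`-mean of the indicator of `A`, which is `P(X_0 ∈ A)`. Letting `t → ∞` identifies the two.
  have hbound : ∀ t : ℝ≥0, 0 < t →
      |(P.map (X s)).real A - (P.map (X 0)).real A| ≤ 2 * Real.exp (-(t * ρ)) := by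
    intro t ht
    have h1 := hgap.abs_integral_sub_le hmX hkm hk1 ht
    have h2 := hgap.abs_integral_sub_le hmX (f := A.indicator fun _ => (1 : ℝ))
      (measurable_one.indicator hA)
      (fun x => by by_cases hx : x ∈ A <;> simp [hx]) (t := t + s) (by positivity)
    rw [hkey, hk0] at h1
    rw [hind, hind0] at h2
    have h3 : Real.exp (-((t + s : ℝ≥0) * ρ)) ≤ Real.exp (-(t * ρ)) := by
      rw [Real.exp_le_exp]
      push_cast
      nlinarith [mul_nonneg s.2 hρ.le]
    rw [abs_le] at *
    constructor <;> linarith [h1.1, h1.2, h2.1, h2.2]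
  have hlim : Tendsto (fun n : ℕ => 2 * Real.exp (-((n : ℝ) * ρ))) atTop (𝓝 (2 * 0)) := by
    refine (Real.tendsto_exp_neg_atTop_nhds_zero.comp ?_).const_mul 2
    exact tendsto_natCast_atTop_atTop.atTop_mul_const hρ
  have hz : |(P.map (X s)).real A - (P.map (X 0)).real A| ≤ 2 * 0 := by
    refine ge_of_tendsto hlim ?_
    filter_upwards [eventually_gt_atTop 0] with n hn
    simpa using hbound n (by exact_mod_cast hn)
  rw [mul_zero, abs_nonpos_iff, sub_eq_zero] at hz
  exact (measureReal_eq_measureReal_iff).1 hz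

end IsSolution

/-! ### Three bounds on the autocovariance -/

theorem abs_integral_le_of_support_subset {α : Type*} [MeasurableSpace α] {ν : Measure α}
    [IsFiniteMeasure ν] {f : α → ℝ} {S : Set α} (hS : MeasurableSet S) (hfS : ∀ x ∉ S, f x = 0)
    {M : ℝ} (hM : ∀ᵐ x ∂ν, x ∈ S → |f x| ≤ M) : |∫ x, f x ∂ν| ≤ M * ν.real S := by
  rw [← setIntegral_eq_integral_of_forall_compl_eq_zero hfS]
  rw [← Real.norm_eq_abs]
  exact norm_setIntegral_le_of_norm_le_const_ae (measure_lt_top ν S)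
    ((ae_restrict_iff' hS).2 hM)

/-- Cauchy–Schwarz, with `‖f‖₂² ≤ M² ν(S)`. -/
theorem abs_integral_mul_le_of_eLpNorm_le {α : Type*} [MeasurableSpace α] {ν : Measure α}
    [IsFiniteMeasure ν] {f g : α → ℝ} (hf : AEStronglyMeasurable f ν)
    (hg : AEStronglyMeasurable g ν) {S : Set α} (hS : MeasurableSet S) (hfS : ∀ x ∉ S, f x = 0)
    {M c : ℝ} (hM : ∀ x, |f x| ≤ M) (hc : 0 ≤ c)
    (hfg : eLpNorm g 2 ν ≤ ENNReal.ofReal c * eLpNorm f 2 ν) :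
    |∫ x, f x * g x ∂ν| ≤ c * (M ^ 2 * ν.real S) := by
  rcases isEmpty_or_nonempty α with h | ⟨⟨x₀⟩⟩
  · simp [Subsingleton.elim ν 0]
  have hM0 : 0 ≤ M := (abs_nonneg _).trans (hM x₀)
  have h1 : eLpNorm f 2 ν ≤ ENNReal.ofReal M * ν S ^ (1 / 2 : ℝ) := by
    have : eLpNorm f 2 ν ≤ eLpNorm (S.indicator fun _ => M) 2 ν := by
      refine eLpNorm_mono fun x => ?_
      by_cases hx : x ∈ S
      · simpa [hx, abs_of_nonneg hM0] using hM x
      · simp [hfS x hx]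
    refine this.trans_eq ?_
    rw [eLpNorm_indicator_const hS (by norm_num) (by norm_num)]
    simp [Real.enorm_eq_ofReal hM0]
  have h2 : eLpNorm (f • g) 1 ν ≤ eLpNorm f 2 ν * eLpNorm g 2 ν :=
    eLpNorm_smul_le_mul_eLpNorm (p := 2) (q := 2) (r := 1) hg hf
  have h3 : ENNReal.ofReal M * ν S ^ (1 / 2 : ℝ) * (ENNReal.ofReal M * ν S ^ (1 / 2 : ℝ))
      = ENNReal.ofReal (M ^ 2 * ν.real S) := by
    rw [mul_mul_mul_comm, ← ENNReal.rpow_add_of_nonneg _ _ (by norm_num) (by norm_num),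
      ← ENNReal.ofReal_mul hM0, ENNReal.ofReal_mul (sq_nonneg M), ofReal_measureReal, ← sq]
    norm_num
  rw [← Real.norm_eq_abs, ← ENNReal.ofReal_le_ofReal_iff (by positivity), ofReal_norm]
  calc _ ≤ ∫⁻ x, ‖f x * g x‖ₑ ∂ν := enorm_integral_le_lintegral_enorm _
    _ = eLpNorm (f • g) 1 ν := eLpNorm_one_eq_lintegral_enorm.symm
    _ ≤ eLpNorm f 2 ν * (ENNReal.ofReal c * eLpNorm f 2 ν) := h2.trans (by gcongr)
    _ = ENNReal.ofReal c * (eLpNorm f 2 ν * eLpNorm f 2 ν) := by ring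
    _ ≤ ENNReal.ofReal c * (ENNReal.ofReal M * ν S ^ (1 / 2 : ℝ)
          * (ENNReal.ofReal M * ν S ^ (1 / 2 : ℝ))) := by gcongr
    _ = _ := by rw [h3, ← ENNReal.ofReal_mul hc]

section Covariance

variable {d : ℕ} {Ω : Type*} [MeasurableSpace Ω] {P : Measure Ω} [IsProbabilityMeasure P]
  {X : ℝ≥0 → Ω → EuclideanSpace ℝ (Fin d)} {f : EuclideanSpace ℝ (Fin d) → ℝ} {M : ℝ}
  {S : Set (EuclideanSpace ℝ (Fin d))}

theorem abs_integral_mul_le_mul_measure (hX : ∀ t, Measurable (X t)) (hf : Measurable f)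
    (hM : ∀ x, |f x| ≤ M) (hS : MeasurableSet S) (hfS : ∀ x ∉ S, f x = 0) (u : ℝ≥0) :
    |∫ ω, f (X 0 ω) * f (X u ω) ∂P| ≤ M ^ 2 * (P.map (X 0)).real S := by
  have hprob : IsProbabilityMeasure (P.map (X 0)) :=
    Measure.isProbabilityMeasure_map (hX 0).aemeasurable
  rw [integral_mul_eq_integral_mul_transitionOp hX hf hf hM hM]
  refine abs_integral_le_of_support_subset hS (fun x hx => by simp [hfS x hx])
    (ae_of_all _ fun x _ => ?_)
  rw [abs_mul, sq]
  exact mul_le_mul (hM x) (abs_transitionOp_le hM u x) (abs_nonneg _) ((abs_nonneg _).trans (hM x))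

/-- The covariance bound that comes from a bound on the transition density. -/
theorem IsTransitionDensity.abs_integral_mul_le (hX : ∀ t, Measurable (X t))
    {p : ℝ≥0 → EuclideanSpace ℝ (Fin d) → EuclideanSpace ℝ (Fin d) → ℝ}
    (hp : IsTransitionDensity P X p) (hf : Measurable f) (hM : ∀ x, |f x| ≤ M)
    (hS : MeasurableSet S) (hfS : ∀ x ∉ S, f x = 0) {u : ℝ≥0} (hu : 0 < u) {B : ℝ} (hB0 : 0 ≤ B)
    (hB : ∀ x ∈ S, ∀ y ∈ S, p u x y ≤ B) (hvol : volume S ≠ ∞) :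
    |∫ ω, f (X 0 ω) * f (X u ω) ∂P|
      ≤ M ^ 2 * (P.map (X 0)).real S * (volume.real S * B) := by
  have hprob : IsProbabilityMeasure (P.map (X 0)) :=
    Measure.isProbabilityMeasure_map (hX 0).aemeasurable
  have hM0 : 0 ≤ M := (abs_nonneg _).trans (hM 0)
  rw [integral_mul_eq_integral_mul_transitionOp hX hf hf hM hM]
  have := abs_integral_le_of_support_subset (ν := P.map (X 0)) (M := M * (M * (volume.real S * B)))
    (f := fun x => f x * transitionOp P X u f x) hS (fun x hx => by simp [hfS x hx]) ?_
  · refine this.trans_eq (by ring)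
  filter_upwards [hp.condDistrib_eq u hu] with x hx hxS
  rw [abs_mul]
  refine mul_le_mul (hM x) ?_ (abs_nonneg _) hM0
  refine (abs_integral_le_of_support_subset hS hfS (ae_of_all _ fun y _ => hM y)).trans ?_
  gcongr
  rw [hx, measureReal_def, withDensity_apply _ hS]
  refine ENNReal.toReal_le_of_le_ofReal (by positivity) ?_
  calc ∫⁻ y in S, ENNReal.ofReal (p u x y) ≤ ∫⁻ _ in S, ENNReal.ofReal B :=
        setLIntegral_mono measurable_const fun y hy => ENNReal.ofReal_le_ofReal (hB x hxS y hy)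
    _ = _ := by
      rw [setLIntegral_const, ENNReal.ofReal_mul measureReal_nonneg, ofReal_measureReal hvol,
        mul_comm]

/-- The covariance bound that comes from the spectral gap. -/
theorem SpectralGap.abs_integral_mul_sub_le (hX : ∀ t, Measurable (X t)) {ρ : ℝ}
    (hgap : SpectralGap P X (P.map (X 0)) ρ) (hf : Measurable f) (hM : ∀ x, |f x| ≤ M)
    (hS : MeasurableSet S) (hfS : ∀ x ∉ S, f x = 0) {u : ℝ≥0} (hu : 0 < u) :
    |∫ ω, f (X 0 ω) * f (X u ω) ∂P - (∫ x, f x ∂(P.map (X 0))) ^ 2|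
      ≤ Real.exp (-(u * ρ)) * (M ^ 2 * (P.map (X 0)).real S) := by
  have hprob : IsProbabilityMeasure (P.map (X 0)) :=
    Measure.isProbabilityMeasure_map (hX 0).aemeasurable
  have hT := measurable_transitionOp (P := P) (X := X) hf u
  have hfb : ∀ᵐ x ∂(P.map (X 0)), ‖f x‖ ≤ M := ae_of_all _ hM
  have hfi : Integrable f (P.map (X 0)) := Integrable.of_bound hf.aestronglyMeasurable M hfb
  have hfTi : Integrable (fun x => f x * transitionOp P X u f x) (P.map (X 0)) :=
    hfi.mul_bdd (c := M) hT.aestronglyMeasurable (ae_of_all _ fun x => abs_transitionOp_le hM u x)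
  rw [integral_mul_eq_integral_mul_transitionOp hX hf hf hM hM]
  have h1 : ∫ x, f x * transitionOp P X u f x ∂(P.map (X 0)) - (∫ x, f x ∂(P.map (X 0))) ^ 2
      = ∫ x, f x * (transitionOp P X u f x - ∫ y, f y ∂(P.map (X 0))) ∂(P.map (X 0)) := by
    simp_rw [mul_sub]
    rw [integral_sub hfTi (hfi.mul_const _), integral_mul_const, sq]
  rw [h1]
  exact abs_integral_mul_le_of_eLpNorm_le hf.aestronglyMeasurable
    (hT.sub_const _).aestronglyMeasurable hS hfS hM (Real.exp_pos _).le
    (hgap f (MemLp.of_bound hf.aestronglyMeasurable M hfb) u hu)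

end Covariance

/-- Stationarity and the Markov property move the pair of times `(s, s + u)` to `(0, u)`, where the
transition operator applies. -/
theorem IsSolution.integral_sub_mul_sub {d : ℕ} {Ω : Type*} [MeasurableSpace Ω] {P : Measure Ω}
    [IsProbabilityMeasure P] {b : EuclideanSpace ℝ (Fin d) → EuclideanSpace ℝ (Fin d)}
    {X W : ℝ≥0 → Ω → EuclideanSpace ℝ (Fin d)} (h : IsSolution b X W P) (hb : Continuous b)
    (hlip : ∀ R : ℝ, ∃ K : ℝ≥0, LipschitzOnWith K b (Metric.closedBall 0 R))
    (hstat : ∀ s, P.map (X s) = P.map (X 0)) {f : EuclideanSpace ℝ (Fin d) → ℝ}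
    (hf : Measurable f) {M : ℝ} (hM : ∀ x, |f x| ≤ M) (s u : ℝ≥0) :
    ∫ ω, (f (X s ω) - ∫ x, f x ∂(P.map (X 0))) * (f (X (s + u) ω) - ∫ x, f x ∂(P.map (X 0))) ∂P
      = ∫ ω, f (X 0 ω) * f (X u ω) ∂P - (∫ x, f x ∂(P.map (X 0))) ^ 2 := by
  have hX := h.measurable
  set c := ∫ x, f x ∂(P.map (X 0)) with hc
  have hfX : ∀ t, Measurable (fun ω => f (X t ω)) := fun t => hf.comp (hX t)
  have hb' : ∀ t, ∀ᵐ ω ∂P, ‖f (X t ω)‖ ≤ M := fun t => ae_of_all _ fun ω => hM _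
  have hi : ∀ t, Integrable (fun ω => f (X t ω)) P := fun t =>
    Integrable.of_bound (hfX t).aestronglyMeasurable M (hb' t)
  have hii : ∀ s t, Integrable (fun ω => f (X s ω) * f (X t ω)) P := fun s t =>
    (hi s).mul_bdd (hfX t).aestronglyMeasurable (hb' t)
  have hmean : ∀ t, ∫ ω, f (X t ω) ∂P = c := fun t => by
    rw [hc, ← hstat t, integral_map (hX t).aemeasurable hf.aestronglyMeasurable]
  have hm : Measurable
      (fun z : EuclideanSpace ℝ (Fin d) × EuclideanSpace ℝ (Fin d) => f z.1 * f z.2) := by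
    fun_prop
  have hpair : ∫ ω, f (X s ω) * f (X (s + u) ω) ∂P = ∫ ω, f (X 0 ω) * f (X u ω) ∂P := by
    have e := congrArg (fun m => ∫ z, f z.1 * f z.2 ∂m)
      (h.map_prodMk_eq_of_map_eq hb hlip (hstat s) u)
    rwa [integral_map ((hX _).prodMk (hX _)).aemeasurable hm.aestronglyMeasurable,
      integral_map ((hX _).prodMk (hX _)).aemeasurable hm.aestronglyMeasurable] at e
  have hexpand : ∀ ω, (f (X s ω) - c) * (f (X (s + u) ω) - c)
      = f (X s ω) * f (X (s + u) ω) - c * f (X s ω) - c * f (X (s + u) ω) + c ^ 2 :=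
    fun ω => by ring
  simp_rw [hexpand]
  have i1 : Integrable (fun ω => f (X s ω) * f (X (s + u) ω) - c * f (X s ω)) P :=
    (hii _ _).sub ((hi _).const_mul c)
  have i2 : Integrable
      (fun ω => f (X s ω) * f (X (s + u) ω) - c * f (X s ω) - c * f (X (s + u) ω)) P :=
    i1.sub ((hi _).const_mul c)
  rw [integral_add i2 (integrable_const _), integral_sub i1 ((hi _).const_mul c),
    integral_sub (hii _ _) ((hi _).const_mul c), integral_const_mul, integral_const_mul, hmean,
    hmean, hpair]
  simp
  ring

/-! ### Integrating the bounds: the rate `s ψ_d(s)²` -/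

/-- The bounds behind the rate in dimension two. -/
theorem rate_bounds_two {r ρ : ℝ} (hr : 0 < r) (hρ : 0 < ρ) :
    ∃ A : ℝ, 0 < A ∧ ∀ s : ℝ, 0 < s → s < 1 →
      r ^ 2 * s ^ (2 / ((2 : ℕ) : ℝ)) ≤ A * (s * psi 2 s ^ 2) ∧ s ≤ A * (s * psi 2 s ^ 2) ∧
      s * ∫ u in Set.Ioc (r ^ 2 * s ^ (2 / ((2 : ℕ) : ℝ))) (Real.log (1 / s) / ρ),
        u ^ (-((2 : ℕ) : ℝ) / 2) ≤ A * (s * psi 2 s ^ 2) ∧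
      s * (Real.log (1 / s) / ρ) ^ (3 * ((2 : ℕ) : ℝ) / 2 + 1) ≤ A * (s * psi 2 s ^ 2) := by
  refine ⟨r ^ 2 + 3 + |Real.log ρ| + |Real.log (r ^ 2)| + 1 / ρ ^ 4, by positivity, ?_⟩
  intro s hs hs1
  set L := Real.log (1 / s) with hL
  set A := r ^ 2 + 3 + |Real.log ρ| + |Real.log (r ^ 2)| + 1 / ρ ^ 4 with hA
  have hLs : Real.log s = -L := by rw [hL, one_div, Real.log_inv, neg_neg]
  have hL0 : 0 < L := Real.log_pos (by rw [lt_div_iff₀ hs]; linarith)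
  have hψ : psi 2 s = max 1 (L ^ 2) := by simp [psi, hL]
  set q := max 1 (L ^ 2) with hq
  have hq1 : 1 ≤ q := le_max_left _ _
  have hq2 : L ^ 2 ≤ q := le_max_right _ _
  have hqq : 1 ≤ q ^ 2 := by nlinarith
  have hLq : L ≤ q ^ 2 := by nlinarith [sq_nonneg (L - 1)]
  have hL4 : L ^ 4 ≤ q ^ 2 := by nlinarith [sq_nonneg L]
  have hρ4 : 0 ≤ 1 / ρ ^ 4 := by positivity
  have h1 := abs_nonneg (Real.log ρ)
  have h2 := abs_nonneg (Real.log (r ^ 2))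
  have h3 := sq_nonneg r
  have hmono : ∀ a : ℝ, a ≤ A * q ^ 2 → s * a ≤ A * (s * q ^ 2) := fun a ha => by
    calc s * a ≤ s * (A * q ^ 2) := by gcongr
      _ = _ := by ring
  have hexp : s ^ (2 / ((2 : ℕ) : ℝ)) = s := by norm_num
  rw [hψ, hexp]
  refine ⟨?_, ?_, ?_, ?_⟩
  · rw [mul_comm]
    refine hmono _ ?_
    nlinarith
  · have := hmono 1 (by nlinarith)
    rwa [mul_one] at this
  · refine hmono _ ?_
    -- The middle range of lags is empty when `r` or `ρ` is large compared with `s`.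
    rcases le_or_gt (L / ρ) (r ^ 2 * s) with h | h
    · rw [Set.Ioc_eq_empty (not_lt.2 h)]
      simp
      positivity
    · have hδ : 0 < r ^ 2 * s := by positivity
      have hfun : (fun u : ℝ => u ^ (-((2 : ℕ) : ℝ) / 2)) = fun u => u⁻¹ := by
        funext u
        rw [show (-((2 : ℕ) : ℝ) / 2) = ((-1 : ℤ) : ℝ) by norm_num, Real.rpow_intCast, zpow_neg_one]
      rw [hfun, ← intervalIntegral.integral_of_le h.le, integral_inv_of_pos hδ (hδ.trans h),
        Real.log_div (hδ.trans h).ne' hδ.ne', Real.log_div hL0.ne' hρ.ne',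
        Real.log_mul (by positivity) hs.ne', hLs]
      have hll : Real.log L ≤ L := (Real.log_le_sub_one_of_pos hL0).trans (by linarith)
      have e1 := neg_abs_le (Real.log ρ)
      have e2 := neg_abs_le (Real.log (r ^ 2))
      calc _ ≤ 2 * L + |Real.log ρ| + |Real.log (r ^ 2)| := by linarith
        _ ≤ 2 * q ^ 2 + |Real.log ρ| * q ^ 2 + |Real.log (r ^ 2)| * q ^ 2 := by
          gcongr <;> nlinarith
        _ ≤ _ := by rw [hA]; nlinarith
  · refine hmono _ ?_
    -- The growing term `u^{3d/2}` costs `L⁴`, which is exactly what `ψ_2²` affords; the integral of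
    -- `u⁻¹` is only of order `L` plus constants.
    rw [show (3 * ((2 : ℕ) : ℝ) / 2 + 1) = ((4 : ℕ) : ℝ) by norm_num, Real.rpow_natCast, div_pow,
      div_eq_mul_one_div]
    calc L ^ 4 * (1 / ρ ^ 4) ≤ q ^ 2 * (1 / ρ ^ 4) := by gcongr
      _ ≤ _ := by rw [hA]; nlinarith

/-- The bounds behind the rate in dimension at least three. -/
theorem rate_bounds_of_three_le {d : ℕ} (hd : 3 ≤ d) {r ρ : ℝ} (hr : 0 < r) (hρ : 0 < ρ) :
    ∃ A : ℝ, 0 < A ∧ ∀ s : ℝ, 0 < s → s < 1 →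
      r ^ 2 * s ^ (2 / (d : ℝ)) ≤ A * (s * psi d s ^ 2) ∧ s ≤ A * (s * psi d s ^ 2) ∧
      s * ∫ u in Set.Ioc (r ^ 2 * s ^ (2 / (d : ℝ))) (Real.log (1 / s) / ρ),
        u ^ (-(d : ℝ) / 2) ≤ A * (s * psi d s ^ 2) ∧
      s * (Real.log (1 / s) / ρ) ^ (3 * (d : ℝ) / 2 + 1) ≤ A * (s * psi d s ^ 2) := by
  have hd3 : (3 : ℝ) ≤ d := by exact_mod_cast hd
  have hdpos : (0 : ℝ) < d := by linarith
  set m : ℝ := 3 * (d : ℝ) / 2 + 1 with hm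
  have hm0 : 0 < m := by positivity
  -- Chosen so that `ε m = 1 - 2/d`: then `log(1/s) ≤ s^{-ε}/ε` bounds `s·log(1/s)^m` by a multiple
  -- of `s^{2/d}`.
  set ε : ℝ := (1 - 2 / d) / m with hε
  have h2d : 2 / (d : ℝ) < 1 := by rw [div_lt_one hdpos]; linarith
  have hε0 : 0 < ε := div_pos (by linarith) hm0
  set A₁ : ℝ := (r ^ 2) ^ (-(d : ℝ) / 2 + 1) / ((d : ℝ) / 2 - 1) with hA₁
  have hd1 : 0 < (d : ℝ) / 2 - 1 := by linarith
  have hA₁0 : 0 ≤ A₁ := by positivity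
  set A₂ : ℝ := (1 / (ε * ρ)) ^ m with hA₂
  have hA₂0 : 0 ≤ A₂ := by positivity
  refine ⟨r ^ 2 + 1 + A₁ + A₂, by positivity, ?_⟩
  intro s hs hs1
  have hψ : s * psi d s ^ 2 = s ^ (2 / (d : ℝ)) := by
    rw [psi, if_neg (by omega), ← Real.rpow_natCast, ← Real.rpow_mul hs.le]
    nth_rw 1 [← Real.rpow_one s]
    rw [← Real.rpow_add hs]
    congr 1
    push_cast
    ring
  rw [hψ]
  set τ := s ^ (2 / (d : ℝ)) with hτ
  have hτ0 : 0 < τ := by positivity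
  have hsτ : s ≤ τ := by
    nth_rw 1 [← Real.rpow_one s]
    exact Real.rpow_le_rpow_of_exponent_ge hs hs1.le h2d.le
  have hr2 := sq_nonneg r
  refine ⟨?_, ?_, ?_, ?_⟩
  · gcongr
    linarith
  · nlinarith
  · have hδ : 0 < r ^ 2 * τ := by positivity
    have hlt : -(d : ℝ) / 2 < -1 := by linarith
    -- As `d/2 > 1`, the integral converges at infinity and its lower end dominates: `s·τ^{1-d/2} =
    -- τ`.
    have hI : ∫ u in Set.Ioc (r ^ 2 * τ) (Real.log (1 / s) / ρ), u ^ (-(d : ℝ) / 2)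
        ≤ ∫ u in Set.Ioi (r ^ 2 * τ), u ^ (-(d : ℝ) / 2) := by
      refine setIntegral_mono_set (integrableOn_Ioi_rpow_of_lt hlt hδ) ?_
        (Set.Ioc_subset_Ioi_self).eventuallyLE
      filter_upwards [ae_restrict_mem measurableSet_Ioi] with u hu
      exact Real.rpow_nonneg (hδ.le.trans (le_of_lt hu)) _
    rw [integral_Ioi_rpow_of_lt hlt hδ] at hI
    have hval : s * (-(r ^ 2 * τ) ^ (-(d : ℝ) / 2 + 1) / (-(d : ℝ) / 2 + 1)) = A₁ * τ := by
      rw [Real.mul_rpow (by positivity) hτ0.le, hA₁]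
      have e1 : s * τ ^ (-(d : ℝ) / 2 + 1) = τ := by
        rw [hτ, ← Real.rpow_mul hs.le]
        nth_rw 1 [← Real.rpow_one s]
        rw [← Real.rpow_add hs]
        congr 1
        field_simp
        ring
      rw [show -(d : ℝ) / 2 + 1 = -((d : ℝ) / 2 - 1) by ring, neg_div_neg_eq] at *
      calc _ = (r ^ 2) ^ (-((d : ℝ) / 2 - 1)) / ((d : ℝ) / 2 - 1)
            * (s * τ ^ (-((d : ℝ) / 2 - 1))) := by ring
        _ = _ := by rw [e1]
    calc _ ≤ _ := mul_le_mul_of_nonneg_left hI hs.le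
      _ = A₁ * τ := hval
      _ ≤ _ := by gcongr; linarith
  · have hL0 : 0 < Real.log (1 / s) := Real.log_pos (by rw [lt_div_iff₀ hs]; linarith)
    have hlog : Real.log (1 / s) ≤ (1 / s) ^ ε / ε := Real.log_le_rpow_div (by positivity) hε0
    have hD : (Real.log (1 / s) / ρ) ^ m ≤ ((1 / s) ^ ε / ε / ρ) ^ m := by gcongr
    have hval : s * ((1 / s) ^ ε / ε / ρ) ^ m = A₂ * τ := by
      rw [show (1 / s) ^ ε / ε / ρ = (1 / (ε * ρ)) * (1 / s) ^ ε by field_simp,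
        Real.mul_rpow (by positivity) (by positivity), ← Real.rpow_mul (by positivity), hA₂,
        show ε * m = 1 - 2 / d by rw [hε]; field_simp, one_div s, Real.inv_rpow hs.le,
        ← Real.rpow_neg hs.le, hτ]
      have : s * s ^ (-(1 - 2 / (d : ℝ))) = s ^ (2 / (d : ℝ)) := by
        nth_rw 1 [← Real.rpow_one s]
        rw [← Real.rpow_add hs]
        congr 1
        ring
      rw [← this]
      ring
    calc _ ≤ _ := mul_le_mul_of_nonneg_left hD hs.le
      _ = A₂ * τ := hval
      _ ≤ _ := by gcongr; linarith

theorem rate_bounds {d : ℕ} (hd : 2 ≤ d) {r ρ : ℝ} (hr : 0 < r) (hρ : 0 < ρ) :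
    ∃ A : ℝ, 0 < A ∧ ∀ s : ℝ, 0 < s → s < 1 →
      r ^ 2 * s ^ (2 / (d : ℝ)) ≤ A * (s * psi d s ^ 2) ∧ s ≤ A * (s * psi d s ^ 2) ∧
      s * ∫ u in Set.Ioc (r ^ 2 * s ^ (2 / (d : ℝ))) (Real.log (1 / s) / ρ),
        u ^ (-(d : ℝ) / 2) ≤ A * (s * psi d s ^ 2) ∧
      s * (Real.log (1 / s) / ρ) ^ (3 * (d : ℝ) / 2 + 1) ≤ A * (s * psi d s ^ 2) := by
  rcases hd.eq_or_lt with rfl | h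
  · exact rate_bounds_two hr hρ
  · exact rate_bounds_of_three_le h hr hρ

/-- An integrable majorant, with integral of the order of the rate, of every function that satisfies
the three bounds on the normalized autocovariance. -/
theorem exists_covariance_majorant {d : ℕ} (hd : 2 ≤ d) {r : ℝ} (hr : 0 < r)
    {C₀ : ℝ} (hC₀ : 0 < C₀) {ρ : ℝ} (hρ : 0 < ρ) :
    ∃ C : ℝ, 0 < C ∧ ∀ s : ℝ, 0 < s → s < 1 → ∃ K : ℝ → ℝ, (∀ u, 0 ≤ K u) ∧
      IntegrableOn K (Set.Ioi 0) ∧ (∫ u in Set.Ioi 0, K u) ≤ C * (s * psi d s ^ 2) ∧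
      ∀ u, 0 < u → ∀ v : ℝ, v ≤ 1 → v ≤ Real.exp (-(u * ρ)) →
        (r ^ 2 * s ^ (2 / (d : ℝ)) < u →
          v ≤ s * (C₀ * (u ^ (-(d : ℝ) / 2) + u ^ (3 * (d : ℝ) / 2)))) → v ≤ K u := by
  obtain ⟨A, hA, hA'⟩ := rate_bounds hd hr hρ
  refine ⟨A + C₀ * (A + A) + A / ρ, by positivity, fun s hs hs1 => ?_⟩
  obtain ⟨h1, h2, h3, h4⟩ := hA' s hs hs1
  have hL0 : 0 < Real.log (1 / s) := Real.log_pos (by rw [lt_div_iff₀ hs]; linarith)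
  set δ := r ^ 2 * s ^ (2 / (d : ℝ)) with hδ
  -- The time at which `e^{-ρu}` has dropped to `s`, so the tail beyond it integrates to `s / ρ`. If
  -- `D ≤ δ`, the middle range is empty and the outer two still cover all lags.
  set D := Real.log (1 / s) / ρ with hD
  set t := s * psi d s ^ 2 with ht
  have hδ0 : 0 < δ := by positivity
  have hD0 : 0 < D := by positivity
  set g₁ : ℝ → ℝ := (Set.Ioc 0 δ).indicator fun _ => 1 with hg₁
  set k₂ : ℝ → ℝ := fun u => s * (C₀ * (u ^ (-(d : ℝ) / 2) + u ^ (3 * (d : ℝ) / 2))) with hk₂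
  set g₂ : ℝ → ℝ := (Set.Ioc δ D).indicator k₂ with hg₂
  set g₃ : ℝ → ℝ := (Set.Ioi D).indicator fun u => Real.exp (-ρ * u) with hg₃
  have hn₁ : ∀ u, 0 ≤ g₁ u := fun u => Set.indicator_nonneg (fun _ _ => zero_le_one) u
  have hn₂ : ∀ u, 0 ≤ g₂ u := Set.indicator_nonneg fun u hu => by
    have : 0 < u := hδ0.trans hu.1
    positivity
  have hn₃ : ∀ u, 0 ≤ g₃ u := Set.indicator_nonneg fun u _ => (Real.exp_pos _).le
  have hp₁ : IntegrableOn (fun u : ℝ => u ^ (-(d : ℝ) / 2)) (Set.Ioc δ D) := by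
    refine (ContinuousOn.integrableOn_Icc fun u hu => ?_).mono_set Set.Ioc_subset_Icc_self
    exact (Real.continuousAt_rpow_const _ _ (Or.inl (hδ0.trans_le hu.1).ne')).continuousWithinAt
  have hp₂ : IntegrableOn (fun u : ℝ => u ^ (3 * (d : ℝ) / 2)) (Set.Ioc δ D) := by
    refine (ContinuousOn.integrableOn_Icc fun u hu => ?_).mono_set Set.Ioc_subset_Icc_self
    exact (Real.continuousAt_rpow_const _ _ (Or.inl (hδ0.trans_le hu.1).ne')).continuousWithinAt
  have hk₂i : IntegrableOn k₂ (Set.Ioc δ D) := ((hp₁.add hp₂).const_mul C₀).const_mul s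
  have hi₁ : Integrable g₁ := (integrable_indicator_iff measurableSet_Ioc).2
    (integrableOn_const (by simp))
  have hi₂ : Integrable g₂ := (integrable_indicator_iff measurableSet_Ioc).2 hk₂i
  have hi₃ : Integrable g₃ := (integrable_indicator_iff measurableSet_Ioi).2
    (integrableOn_exp_mul_Ioi (by linarith) D)
  have hI₁ : ∫ u, g₁ u = δ := by
    rw [hg₁, integral_indicator measurableSet_Ioc]
    simp [hδ0.le]
  have hI₃ : ∫ u, g₃ u = s / ρ := by
    rw [hg₃, integral_indicator measurableSet_Ioi, integral_exp_mul_Ioi (by linarith)]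
    rw [show -ρ * D = Real.log s by
      rw [hD, one_div, Real.log_inv]; field_simp, Real.exp_log hs]
    rw [neg_div_neg_eq]
  have hpow : ∫ u in Set.Ioc δ D, u ^ (3 * (d : ℝ) / 2) ≤ D ^ (3 * (d : ℝ) / 2 + 1) := by
    have hb := norm_setIntegral_le_of_norm_le_const (μ := volume) (s := Set.Ioc δ D)
      (f := fun u : ℝ => u ^ (3 * (d : ℝ) / 2)) (C := D ^ (3 * (d : ℝ) / 2)) (by simp)
      (fun u hu => by
        have h0 : 0 < u := hδ0.trans hu.1
        rw [Real.norm_of_nonneg (by positivity)]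
        have := hu.2
        gcongr)
    refine (le_abs_self _).trans (hb.trans ?_)
    rw [Real.rpow_add_one hD0.ne', Real.volume_real_Ioc]
    gcongr
    exact max_le (by linarith) hD0.le
  have hI₂ : ∫ u, g₂ u ≤ C₀ * (A + A) * t := by
    rw [hg₂, integral_indicator measurableSet_Ioc, hk₂, integral_const_mul, integral_const_mul,
      integral_add hp₁ hp₂]
    calc _ = C₀ * (s * (∫ u in Set.Ioc δ D, u ^ (-(d : ℝ) / 2))
          + s * ∫ u in Set.Ioc δ D, u ^ (3 * (d : ℝ) / 2)) := by ring
      _ ≤ C₀ * (A * t + A * t) := by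
        exact mul_le_mul_of_nonneg_left
          (add_le_add h3 ((mul_le_mul_of_nonneg_left hpow hs.le).trans h4)) hC₀.le
      _ = _ := by ring
  have hKi : Integrable (fun u => g₁ u + g₂ u + g₃ u) := (hi₁.add hi₂).add hi₃
  refine ⟨fun u => g₁ u + g₂ u + g₃ u, fun u => add_nonneg (add_nonneg (hn₁ u) (hn₂ u)) (hn₃ u),
    hKi.integrableOn, ?_, fun u hu v hv1 hv2 hv3 => ?_⟩
  · refine (setIntegral_le_integral hKi (ae_of_all _ fun u =>
      add_nonneg (add_nonneg (hn₁ u) (hn₂ u)) (hn₃ u))).trans ?_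
    rw [integral_add (f := fun u => g₁ u + g₂ u) (hi₁.add hi₂) hi₃, integral_add hi₁ hi₂, hI₁, hI₃]
    have : s / ρ ≤ A * t / ρ := by gcongr
    calc _ ≤ A * t + C₀ * (A + A) * t + A * t / ρ := by gcongr
      _ = _ := by ring
  · rcases le_or_gt u δ with hu1 | hu1
    · have : g₁ u = 1 := Set.indicator_of_mem (show u ∈ Set.Ioc 0 δ from ⟨hu, hu1⟩) _
      linarith [hn₂ u, hn₃ u]
    · rcases le_or_gt u D with hu2 | hu2
      · have : g₂ u = k₂ u := Set.indicator_of_mem (show u ∈ Set.Ioc δ D from ⟨hu1, hu2⟩) _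
        linarith [hn₁ u, hn₃ u, hv3 hu1]
      · have : g₃ u = Real.exp (-ρ * u) :=
          Set.indicator_of_mem (show u ∈ Set.Ioi D from hu2) _
        rw [show -(u * ρ) = -ρ * u by ring] at hv2
        linarith [hn₁ u, hn₂ u]

/-! ### From autocovariance to variance of the time integral -/

theorem integrable_comp_abs {K : ℝ → ℝ} (hK : IntegrableOn K (Set.Ioi 0)) :
    Integrable fun u : ℝ => K |u| := by
  have h1 := (integrable_indicator_iff measurableSet_Ioi).2 hK
  refine (h1.add h1.comp_neg).congr ?_
  have hne : ∀ᵐ u : ℝ, u ≠ 0 := by simp [ae_iff]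
  filter_upwards [hne] with u hu
  rcases lt_or_gt_of_ne hu with h | h
  · simp [h, h.le, abs_of_neg]
  · simp [h, h.le, abs_of_pos]

/-- Second moment of a time integral of a process with integrable autocovariance bound. -/
theorem integral_sq_integral_le {Ω : Type*} [MeasurableSpace Ω] {P : Measure Ω}
    [IsProbabilityMeasure P] {Y : ℝ → Ω → ℝ} (hY : Measurable (Function.uncurry Y)) {B : ℝ}
    (hB : ∀ t ω, |Y t ω| ≤ B) {K : ℝ → ℝ} (hK0 : ∀ u, 0 ≤ K u) (hK : IntegrableOn K (Set.Ioi 0))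
    (hcov : ∀ s t, 0 < s → s < t → ∫ ω, Y s ω * Y t ω ∂P ≤ K (t - s)) {T : ℝ} (hT : 0 < T) :
    ∫ ω, (∫ t in (0 : ℝ)..T, Y t ω) ^ 2 ∂P ≤ 2 * T * ∫ u in Set.Ioi 0, K u := by
  have hYt : ∀ t, Measurable (Y t) := fun t => hY.comp measurable_prodMk_left
  have hYω : ∀ ω, Measurable fun t => Y t ω := fun ω => hY.comp measurable_prodMk_right
  set m := (volume : Measure ℝ).restrict (Set.Ioc 0 T) with hm
  have hBB : ∀ s t ω, ‖Y s ω * Y t ω‖ ≤ B * B := fun s t ω => by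
    rw [norm_mul]
    exact mul_le_mul (hB _ _) (hB _ _) (norm_nonneg _) ((abs_nonneg _).trans (hB s ω))
  have hsq : ∀ ω, (∫ t in (0 : ℝ)..T, Y t ω) ^ 2 = ∫ z, Y z.1 ω * Y z.2 ω ∂(m.prod m) := by
    intro ω
    rw [intervalIntegral.integral_of_le hT.le, sq, ← hm]
    exact (integral_prod_mul (fun t => Y t ω) (fun t => Y t ω)).symm
  have hmeas : Measurable fun q : Ω × (ℝ × ℝ) => Y q.2.1 q.1 * Y q.2.2 q.1 :=
    (hY.comp (measurable_snd.fst.prodMk measurable_fst)).mul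
      (hY.comp (measurable_snd.snd.prodMk measurable_fst))
  have hint : Integrable (Function.uncurry fun (ω : Ω) (z : ℝ × ℝ) => Y z.1 ω * Y z.2 ω)
      (P.prod (m.prod m)) :=
    Integrable.of_bound hmeas.aestronglyMeasurable (B * B) (ae_of_all _ fun q => hBB _ _ _)
  simp_rw [hsq]
  rw [integral_integral_swap hint]
  have hint2 : Integrable (fun z : ℝ × ℝ => ∫ ω, Y z.1 ω * Y z.2 ω ∂P) (m.prod m) :=
    hint.integral_prod_right
  rw [integral_prod _ hint2]
  have hKabs : Integrable fun u : ℝ => K |u| := integrable_comp_abs hK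
  set I := ∫ u in Set.Ioi 0, K u with hI
  -- For fixed `s` the majorant `K |t - s|` is integrated over the whole line, which doubles the
  -- half-line integral. The diagonal `t = s`, where no bound is assumed, is null.
  have hin : ∀ᵐ s ∂m, ∫ t, ∫ ω, Y s ω * Y t ω ∂P ∂m ≤ 2 * I := by
    filter_upwards [ae_restrict_mem measurableSet_Ioc] with s hs
    have hKs : Integrable fun t : ℝ => K |t - s| := hKabs.comp_sub_right s
    have hst : Measurable fun t => ∫ ω, Y s ω * Y t ω ∂P :=
      (StronglyMeasurable.integral_prod_right' (f := fun q : ℝ × Ω => Y s q.2 * Y q.1 q.2)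
        (((hYt s).comp measurable_snd).mul hY).stronglyMeasurable).measurable
    calc ∫ t, ∫ ω, Y s ω * Y t ω ∂P ∂m ≤ ∫ t, K |t - s| ∂m := by
          refine integral_mono_ae ?_ hKs.integrableOn ?_
          · refine Integrable.of_bound hst.aestronglyMeasurable (B * B) (ae_of_all _ fun t => ?_)
            have := norm_integral_le_of_norm_le_const (μ := P) (ae_of_all _ fun ω => hBB s t ω)
            simpa using this
          · have hne : ∀ᵐ t ∂m, t ≠ s := by
              refine ae_restrict_of_ae ?_
              simp [ae_iff]
            filter_upwards [ae_restrict_mem measurableSet_Ioc, hne] with t ht hts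
            rcases lt_or_gt_of_ne hts with h | h
            · have := hcov t s ht.1 h
              rw [abs_of_neg (by linarith), neg_sub]
              simpa only [mul_comm] using this
            · rw [abs_of_pos (by linarith)]
              exact hcov s t hs.1 h
      _ ≤ ∫ t, K |t - s| := setIntegral_le_integral hKs (ae_of_all _ fun t => hK0 _)
      _ = ∫ t, K |t| := integral_sub_right_eq_self (fun t => K |t|) s
      _ = 2 * I := integral_comp_abs
  calc _ ≤ ∫ _, 2 * I ∂m := integral_mono_ae hint2.integral_prod_left (integrable_const _) hin
    _ = 2 * T * I := by
      rw [integral_const, hm, smul_eq_mul]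
      simp [measureReal_def, hT.le]
      ring

/-- A process with almost surely continuous paths is indistinguishable from a measurable process
with continuous paths. -/
theorem exists_continuous_measurable_version {Ω E : Type*} [MeasurableSpace Ω] [TopologicalSpace E]
    [MeasurableSpace E] [Zero E] {P : Measure Ω} {X : ℝ≥0 → Ω → E} (hX : ∀ t, Measurable (X t))
    (hc : ∀ᵐ ω ∂P, Continuous fun t => X t ω) :
    ∃ X' : ℝ≥0 → Ω → E, (∀ t, Measurable (X' t)) ∧ (∀ ω, Continuous fun t => X' t ω) ∧
      ∀ᵐ ω ∂P, ∀ t, X' t ω = X t ω := by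
  classical
  obtain ⟨N, hN, hNm, hN0⟩ := exists_measurable_superset_of_null hc
  refine ⟨fun t ω => if ω ∈ N then 0 else X t ω,
    fun t => Measurable.ite hNm measurable_const (hX t), fun ω => ?_, ?_⟩
  · by_cases h : ω ∈ N
    · simpa [h] using continuous_const
    · simp only [h, if_false]
      by_contra hcon
      exact h (hN hcon)
  · filter_upwards [measure_eq_zero_iff_ae_notMem.1 hN0] with ω hω t
    simp [hω]

theorem contDiff_gradient {d : ℕ} {V : EuclideanSpace ℝ (Fin d) → ℝ} (hV : ContDiff ℝ 2 V) :
    ContDiff ℝ 1 (gradient V) := by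
  have h1 : ContDiff ℝ 1 (fderiv ℝ V) := hV.fderiv_right (by norm_num)
  exact ((InnerProductSpace.toDual ℝ (EuclideanSpace ℝ (Fin d))).symm.toContinuousLinearEquiv
    |>.contDiff).comp h1

theorem exists_lipschitzOnWith_closedBall {d : ℕ}
    {b : EuclideanSpace ℝ (Fin d) → EuclideanSpace ℝ (Fin d)} (hb : ContDiff ℝ 1 b) (R : ℝ) :
    ∃ K : ℝ≥0, LipschitzOnWith K b (Metric.closedBall 0 R) := by
  obtain ⟨C, hC⟩ := (isCompact_closedBall (0 : EuclideanSpace ℝ (Fin d)) R).exists_bound_of_continuousOn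
    (hb.continuous_fderiv one_ne_zero).continuousOn
  refine ⟨C.toNNReal, (convex_closedBall _ _).lipschitzOnWith_of_nnnorm_fderiv_le (𝕜 := ℝ)
    (fun x _ => hb.differentiable one_ne_zero x) fun x hx => ?_⟩
  rw [← NNReal.coe_le_coe, coe_nnnorm]
  exact (hC x hx).trans (Real.le_coe_toNNReal C)

/-- The diameter condition raised to the power `2/d`: beyond this lag the density bound applies to
every pair of points of `S`. -/
theorem sq_norm_sub_le_of_ediam_pow_lt {d : ℕ} (hd : 2 ≤ d) {r : ℝ} (hr : 0 < r)
    {S : Set (EuclideanSpace ℝ (Fin d))} (hvol : volume S ≠ ∞)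
    (hS : Metric.ediam S ^ d < ENNReal.ofReal r ^ d * volume S) {x y : EuclideanSpace ℝ (Fin d)}
    (hx : x ∈ S) (hy : y ∈ S) : ‖x - y‖ ^ 2 ≤ r ^ 2 * volume.real S ^ (2 / (d : ℝ)) := by
  have hd0 : (d : ℝ) ≠ 0 := by positivity
  have h1 : ENNReal.ofReal (‖x - y‖ ^ d) ≤ ENNReal.ofReal (r ^ d * volume.real S) := by
    rw [ENNReal.ofReal_pow (norm_nonneg _), ← dist_eq_norm, ← edist_dist,
      ENNReal.ofReal_mul (by positivity), ENNReal.ofReal_pow hr.le, ofReal_measureReal hvol]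
    exact (pow_le_pow_left' (Metric.edist_le_ediam_of_mem hx hy) d).trans hS.le
  rw [ENNReal.ofReal_le_ofReal_iff (by positivity)] at h1
  have h2 := Real.rpow_le_rpow (by positivity) h1 (show 0 ≤ 2 / (d : ℝ) by positivity)
  rw [Real.mul_rpow (by positivity) measureReal_nonneg, ← Real.rpow_natCast, ← Real.rpow_natCast,
    ← Real.rpow_mul (norm_nonneg _), ← Real.rpow_mul hr.le, mul_div_cancel₀ _ hd0] at h2
  exact_mod_cast h2

section TimeIntegral

variable {d : ℕ} {Ω : Type*} [MeasurableSpace Ω] {P : Measure Ω} [IsProbabilityMeasure P]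
  {X : ℝ≥0 → Ω → EuclideanSpace ℝ (Fin d)} {f : EuclideanSpace ℝ (Fin d) → ℝ} {M : ℝ}

/-- Subtracting any constant `c` leaves the variance unchanged, and the variance is at most the
second moment. The continuous version supplies joint measurability in time and `ω`. -/
theorem memLp_two_and_variance_timeIntegral_le (hX : ∀ t, Measurable (X t))
    (hc : ∀ᵐ ω ∂P, Continuous fun t => X t ω) (hf : Measurable f) (hM : ∀ x, |f x| ≤ M) (c : ℝ)
    {K : ℝ → ℝ} (hK0 : ∀ u, 0 ≤ K u) (hK : IntegrableOn K (Set.Ioi 0))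
    (hcov : ∀ s u : ℝ≥0, 0 < u → ∫ ω, (f (X s ω) - c) * (f (X (s + u) ω) - c) ∂P ≤ K u)
    {T : ℝ} (hT : 0 < T) :
    MemLp (fun ω => ∫ t in (0 : ℝ)..T, f (X t.toNNReal ω)) 2 P ∧
      variance (fun ω => ∫ t in (0 : ℝ)..T, f (X t.toNNReal ω)) P
        ≤ 2 * T * ∫ u in Set.Ioi 0, K u := by
  obtain ⟨X', hX'm, hX'c, hX'⟩ := exists_continuous_measurable_version hX hc
  have hjoint : Measurable (Function.uncurry X') :=
    measurable_uncurry_of_continuous_of_measurable hX'c hX'm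
  set Y : ℝ → Ω → ℝ := fun t ω => f (X' t.toNNReal ω) - c with hYdef
  have hY : Measurable (Function.uncurry Y) :=
    (hf.comp (hjoint.comp ((measurable_real_toNNReal.comp measurable_fst).prodMk
      measurable_snd))).sub_const c
  have hYB : ∀ t ω, |Y t ω| ≤ M + |c| := fun t ω =>
    (abs_sub _ _).trans (by gcongr; exact hM _)
  have hcovY : ∀ s t, 0 < s → s < t → ∫ ω, Y s ω * Y t ω ∂P ≤ K (t - s) := by
    intro s t hs hst
    have h1 := hcov s.toNNReal (t - s).toNNReal (by simpa using hst)
    rw [← Real.toNNReal_add hs.le (by linarith), add_sub_cancel,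
      Real.coe_toNNReal _ (by linarith)] at h1
    refine le_of_eq_of_le (integral_congr_ae ?_) h1
    filter_upwards [hX'] with ω hω
    simp only [hYdef, hω]
  have hsecond := integral_sq_integral_le hY hYB hK0 hK hcovY hT
  have hint : ∀ ω, IntervalIntegrable (fun t : ℝ => Y t ω) volume 0 T := fun ω => by
    rw [intervalIntegrable_iff]
    exact Measure.integrableOn_of_bounded (M := M + |c|) (by simp)
      (hY.comp measurable_prodMk_right).aestronglyMeasurable (ae_of_all _ fun t => hYB t ω)
  set Z : Ω → ℝ := fun ω => ∫ t in (0 : ℝ)..T, Y t ω with hZ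
  have hZm : Measurable Z := by
    have : Z = fun ω => ∫ t in Set.Ioc 0 T, Y t ω :=
      funext fun ω => intervalIntegral.integral_of_le hT.le
    rw [this]
    exact (StronglyMeasurable.integral_prod_right'
      (hY.comp measurable_swap).stronglyMeasurable).measurable
  have hZb : ∀ ω, ‖Z ω‖ ≤ (M + |c|) * T := fun ω => by
    have := intervalIntegral.norm_integral_le_of_norm_le_const (a := 0) (b := T)
      (f := fun t => Y t ω) fun t _ => hYB t ω
    simpa [abs_of_pos hT] using this
  have hZL : MemLp Z 2 P := MemLp.of_bound hZm.aestronglyMeasurable _ (ae_of_all _ hZb)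
  have hae : (fun ω => ∫ t in (0 : ℝ)..T, f (X t.toNNReal ω)) =ᵐ[P] fun ω => Z ω + T * c := by
    filter_upwards [hX'] with ω hω
    have : ∀ t : ℝ, f (X t.toNNReal ω) = Y t ω + c := fun t => by simp [hYdef, hω]
    simp_rw [this]
    rw [intervalIntegral.integral_add (hint ω) (by simp)]
    simp [hZ]
  refine ⟨(memLp_congr_ae hae).2 (hZL.add (memLp_const _)), ?_⟩
  rw [variance_congr hae, variance_add_const hZm.aestronglyMeasurable]
  exact (variance_le_expectation_sq hZm.aestronglyMeasurable).trans hsecond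

end TimeIntegral

end LangevinDiffusion

/-! ### Assembly -/

theorem proposition1 (d : ℕ) (hd : 2 ≤ d) (r : ℝ) (hr : 0 < r)
    (C₀ : ℝ) (hC₀ : 0 < C₀) (ρ : ℝ) (hρ : 0 < ρ) :
    ∃ C : ℝ, 0 < C ∧
      ∀ (V : EuclideanSpace ℝ (Fin d) → ℝ), ContDiff ℝ 2 V →
        Integrable (fun u => Real.exp (-2 * V u)) →
      ∀ (Ω : Type*) [MeasurableSpace Ω] (P : Measure Ω) [IsProbabilityMeasure P]
        (X W : ℝ≥0 → Ω → EuclideanSpace ℝ (Fin d)),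
        LangevinDiffusion.IsSolution (fun x => -gradient V x) X W P →
        P.map (X 0) = LangevinDiffusion.gibbsMeasure V →
        LangevinDiffusion.SpectralGap P X (LangevinDiffusion.gibbsMeasure V) ρ →
      ∀ (p : ℝ≥0 → EuclideanSpace ℝ (Fin d) → EuclideanSpace ℝ (Fin d) → ℝ),
        LangevinDiffusion.IsTransitionDensity P X p →
        LangevinDiffusion.TransitionDensityBound p C₀ →
      ∀ (f : EuclideanSpace ℝ (Fin d) → ℝ), Measurable f →
        BddAbove (Set.range fun x => |f x|) →
      ∀ (S : Set (EuclideanSpace ℝ (Fin d))), MeasurableSet S → Function.support f ⊆ S →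
        Metric.ediam S ^ d < ENNReal.ofReal r ^ d * volume S → volume S < 1 →
      ∀ (T : ℝ), 0 < T →
        MemLp (fun ω => ∫ t in (0 : ℝ)..T, f (X t.toNNReal ω)) 2 P ∧
        variance (fun ω => ∫ t in (0 : ℝ)..T, f (X t.toNNReal ω)) P
          ≤ C * T * (⨆ x, |f x|) ^ 2 * (LangevinDiffusion.gibbsMeasure V).real S
              * volume.real S * LangevinDiffusion.psi d (volume.real S) ^ 2 := by
  open LangevinDiffusion in
  obtain ⟨C, hC, hmaj⟩ := exists_covariance_majorant hd hr hC₀ hρ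
  refine ⟨2 * C, by positivity, ?_⟩
  intro V hV _ Ω _ P _ X W hsol hmap hgap p hp hpb f hf hfb S hS hfS hdiam hS1 T hT
  rw [← hmap] at hgap ⊢
  have hb : ContDiff ℝ 1 fun x => -gradient V x := (contDiff_gradient hV).neg
  have hlip := exists_lipschitzOnWith_closedBall hb
  have hstat := hsol.map_eq_map_zero hb.continuous hlip hρ hgap
  set M := ⨆ x, |f x| with hMdef
  have hM : ∀ x, |f x| ≤ M := fun x => le_ciSup hfb x
  have hf0 : ∀ x ∉ S, f x = 0 := fun x hx => by
    by_contra hne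
    exact hx (hfS hne)
  have hvol : volume S ≠ ∞ := (hS1.trans ENNReal.one_lt_top).ne
  set s := volume.real S with hs
  -- The strict diameter inequality cannot hold when `S` is null.
  have hs0 : 0 < s := by
    refine ENNReal.toReal_pos (fun h0 => ?_) hvol
    simp [h0] at hdiam
  have hs1 : s < 1 := by
    have := (ENNReal.toReal_lt_toReal hvol ENNReal.one_ne_top).2 hS1
    simpa [hs, measureReal_def] using this
  obtain ⟨K, hK0, hKi, hKle, hKmaj⟩ := hmaj s hs0 hs1
  set a := M ^ 2 * (P.map (X 0)).real S with ha
  have ha0 : 0 ≤ a := by positivity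
  have hcov : ∀ v u : ℝ≥0, 0 < u → ∫ ω, (f (X v ω) - ∫ x, f x ∂(P.map (X 0)))
      * (f (X (v + u) ω) - ∫ x, f x ∂(P.map (X 0))) ∂P ≤ a * K u := by
    intro v u hu
    rw [hsol.integral_sub_mul_sub hb.continuous hlip hstat hf hM v u]
    set G := ∫ ω, f (X 0 ω) * f (X u ω) ∂P with hG
    set c := ∫ x, f x ∂(P.map (X 0)) with hc
    have h1 : G - c ^ 2 ≤ a := by
      have := abs_integral_mul_le_mul_measure (P := P) hsol.measurable hf hM hS hf0 u
      linarith [le_abs_self G, sq_nonneg c]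
    have h2 : G - c ^ 2 ≤ Real.exp (-(u * ρ)) * a :=
      (le_abs_self _).trans (hgap.abs_integral_mul_sub_le hsol.measurable hf hM hS hf0 hu)
    have h3 : r ^ 2 * s ^ (2 / (d : ℝ)) < u → G - c ^ 2
        ≤ a * (s * (C₀ * ((u : ℝ) ^ (-(d : ℝ) / 2) + (u : ℝ) ^ (3 * (d : ℝ) / 2)))) := by
      intro hu'
      have := hp.abs_integral_mul_le hsol.measurable hf hM hS hf0 hu
        (B := C₀ * ((u : ℝ) ^ (-(d : ℝ) / 2) + (u : ℝ) ^ (3 * (d : ℝ) / 2))) (by positivity)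
        (fun x hx y hy => hpb u hu x y
          ((sq_norm_sub_le_of_ediam_pow_lt hd hr hvol hdiam hx hy).trans_lt hu')) hvol
      linarith [le_abs_self G, sq_nonneg c]
    -- The majorant is stated for the covariance divided by `a`; for `a = 0` the trivial bound
    -- suffices.
    rcases ha0.eq_or_lt with h0 | hpos
    · rw [← h0] at h1 ⊢
      simpa using h1
    · have := hKmaj u (by exact_mod_cast hu) ((G - c ^ 2) / a) ((div_le_one hpos).2 h1)
        ((div_le_iff₀ hpos).2 h2) fun hu' => (div_le_iff₀' hpos).2 (h3 hu')
      rwa [div_le_iff₀' hpos] at this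
  obtain ⟨hL, hvar⟩ := memLp_two_and_variance_timeIntegral_le hsol.measurable
    hsol.continuous_paths hf hM (∫ x, f x ∂(P.map (X 0))) (K := fun u => a * K u)
    (fun u => mul_nonneg ha0 (hK0 u)) (hKi.const_mul a) hcov hT
  refine ⟨hL, hvar.trans ?_⟩
  rw [integral_const_mul]
  calc 2 * T * (a * ∫ u in Set.Ioi 0, K u) ≤ 2 * T * (a * (C * (s * psi d s ^ 2))) := by gcongr
    _ = _ := by rw [ha]; ring
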